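/- Let $d\ge 2$, $\alpha\in(0,2)$ and $\beta\in((\alpha-1)_+,1]$, and write $y=(\widetilde y,y_d)\in\mathbb R^{d-1}\times\mathbb R$ for $y\in\mathbb R^d$. Let $$\mathcal A(d,-\alpha)=\frac{\alpha\,2^{\alpha-1}\,\Gamma(\frac{d+\alpha}{2})}{\pi^{d/2}\,\Gamma(1-\frac{\alpha}{2})},\qquad C(1,p)=\mathcal A(d,-\alpha)\,\frac{\omega_{d-1}}{2}\,\mathrm B\Big(\frac{\alpha+1}{2},\frac{d-1}{2}\Big)\int_0^1\frac{(t^p-1)(1-t^{\alpha-p-1})}{(1-t)^{1+\alpha}}\,dt,$$ where $\mathrm B$ is the beta function and $\omega_{d-1}$ is the area of the unit sphere of $\mathbb R^{d-1}$ (so $\omega_1=2$). For $\Lambda>0$, consider functions $\Gamma:\mathbb R^{d-1}\to\mathbb R$ that are differentiable and satisfy $\Gamma(0)=0$, $\nabla\Gamma(0)=0$, $|\nabla\Gamma(u)|\le\Lambda$ and $|\nabla\Gamma(u)-\nabla\Gamma(v)|\le\Lambda|u-v|^\beta$ for all $u,v\in\mathbb R^{d-1}$. For such $\Gamma$ put $$D_\Gamma=\{y: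 y_d>\Gamma(\widetilde y)\},\qquad h(y)=|y_d-\Gamma(\widetilde y)|,\qquad \delta(y)=\operatorname{dist}(y,D_\Gamma^c).$$ Proposition. There is $\gamma=\gamma(\alpha,\beta)>0$ such that for all $d\ge2$, $\Lambda>0$, $r_1>0$ and $p\in[\alpha-1,\alpha)\cap(0,\alpha)$ there is a constant $A_1>0$, depending only on $d,\alpha,\beta,\Lambda,p,r_1$, such that for every $\Gamma$ as above and every $x\in D_\Gamma$ with $|x|<r_1$ the following holds. For every $\varepsilon>0$ the function $y\mapsto (h(y)^p-h(x)^p)|y-x|^{-d-\alpha}$ is integrable on $D_\Gamma\cap\{|y-x|\ge\varepsilon\}$, the principal value $$\mathrm{p.v.}\int_{D_\Gamma}\frac{h(y)^p-h(x)^p}{|y-x|^{d+\alpha}}\,dy=\lim_{\varepsilon\downarrow0}\int_{D_\Gamma\cap\{|y-x|\ge\varepsilon\}}\frac{h(y)^p-h(x)^p}{|y-x|^{d+\alpha}}\,dy$$ exists and is finite, and $$\Big|\mathcal A(d,-\alpha)\,\mathrm{p.v.}\int_{D_\Gamma}\frac{h(y)^p-h(x)^p}{|y-x|^{d+\alpha}}\,dy-C(1,p)\,h(x)^p\,\delta(x)^{-\alpha}\Big|\le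 A_1\big(1+\delta(x)^{p-\alpha+\gamma}+|\log\delta(x)|\big).$$ -/

import Mathlib

open Set Filter Topology MeasureTheory

namespace VerticalDistance

noncomputable section

/-- The first `n` coordinates of a point of `ℝ^(n+1)`. -/
def tangential {n : ℕ} (y : EuclideanSpace ℝ (Fin (n + 1))) : EuclideanSpace ℝ (Fin n) :=
  WithLp.toLp 2 (fun i : Fin n => y i.castSucc)

/-- The last coordinate of a point of `ℝ^(n+1)`. -/
def height {n : ℕ} (y : EuclideanSpace ℝ (Fin (n + 1))) : ℝ := y (Fin.last n)

/-- `G` is a `C^{1,β}` function with constant `Λ`: it is differentiable, its gradient is bounded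
by `Λ`, and its gradient is `β`-Hölder continuous with constant `Λ`. -/
structure IsC1Holder {n : ℕ} (β Λ : ℝ) (G : EuclideanSpace ℝ (Fin n) → ℝ) : Prop where
  differentiable : Differentiable ℝ G
  gradient_le : ∀ u, ‖gradient G u‖ ≤ Λ
  gradient_holder : ∀ u v, ‖gradient G u - gradient G v‖ ≤ Λ * ‖u - v‖ ^ β

/-- The region above the graph of `G`. -/
def aboveGraph {n : ℕ} (G : EuclideanSpace ℝ (Fin n) → ℝ) :
    Set (EuclideanSpace ℝ (Fin (n + 1))) :=
  {y | G (tangential y) < height y}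

/-- The vertical distance of `y` to the graph of `G`. -/
def vertDist {n : ℕ} (G : EuclideanSpace ℝ (Fin n) → ℝ)
    (y : EuclideanSpace ℝ (Fin (n + 1))) : ℝ :=
  |height y - G (tangential y)|

/-- `L` is the principal value at `x` of the integral of `f` over `D`: `f` is integrable on `D`
away from `x`, and the integrals over `D ∖ B(x, ε)` converge to `L` as `ε ↓ 0`. -/
def HasPrincipalValue {n : ℕ} (D : Set (EuclideanSpace ℝ (Fin n)))
    (f : EuclideanSpace ℝ (Fin n) → ℝ) (x : EuclideanSpace ℝ (Fin n)) (L : ℝ) : Prop :=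
  (∀ ε : ℝ, 0 < ε → IntegrableOn f (D \ Metric.ball x ε) volume) ∧
    Tendsto (fun ε : ℝ => ∫ y in D \ Metric.ball x ε, f y) (𝓝[>] 0) (𝓝 L)

/-- The normalizing constant `𝒜(d, -α)` of the fractional Laplacian on `ℝ^d`. -/
def normConst (d : ℕ) (α : ℝ) : ℝ :=
  α * 2 ^ (α - 1) * Real.Gamma (((d : ℝ) + α) / 2) /
    (Real.pi ^ ((d : ℝ) / 2) * Real.Gamma (1 - α / 2))

/-- The surface area of the unit sphere of `ℝ^n` (equal to `2` for `n = 1`). -/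
def sphereArea (n : ℕ) : ℝ :=
  (volume : Measure (EuclideanSpace ℝ (Fin n))).toSphere.real univ

/-- `γ(α, p) = ∫_0^1 (t^p - 1)(1 - t^(α-p-1)) / (1-t)^(1+α) dt`. -/
def gammaConst (α p : ℝ) : ℝ :=
  ∫ t in (0 : ℝ)..1, (t ^ p - 1) * (1 - t ^ (α - p - 1)) / (1 - t) ^ (1 + α)

/-- The constant `C(1, p)` in dimension `d`. -/
def codimOneConst (d : ℕ) (α p : ℝ) : ℝ :=
  normConst d α * (sphereArea (d - 1) / 2) *
    ProbabilityTheory.beta ((α + 1) / 2) (((d : ℝ) - 1) / 2) * gammaConst α p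

end

end VerticalDistance

/-! Write `n = d - 1`, `m = (n + 1 + α) / 2`, `h = h(x)`, `a = ∇Γ(x̃)`, `c = √(1 + |a|²)`. The shear
`(u, t) ↦ (x̃ + u, Γ(x̃ + u) + t)` preserves volume, maps the half-space `t > 0` onto `D_Γ` and
turns the vertical distance into `t`. With the kernel regularised to `(|y - x|² + η²)^(-m)`, the
integral becomes `∫_0^∞ (t^p - h^p) S_φ(t - h) dt`, where `S_φ` (`slabKernel`) is the kernel
integrated over `u` and `φ(u) = Γ(x̃ + u) - Γ(x̃)`.

For the tangent plane, `ψ(u) = ⟨a, u⟩`, completing the square computes `S_ψ` exactly. As `η ↓ 0` the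
one-dimensional integral tends to `K γ(α, p) h^p (h/c)^(-α)`, where `K` is `bracketIntegral n m`;
the beta function and sphere area in `C(1, p)` are the value of `K`
(`tendsto_integral_linear_slabKernel`, `bracketIntegral_eq_sphereArea_mul_beta`).

Replacing `φ` by `ψ` gains `β` powers of distance: `|S_φ - S_ψ|(s)` is at most a constant times
`|s|^(-1-α+β)`, and also times `|s|^(-1-α)`, uniformly in `η`. Against `|t^p - h^p|` this integrates
to `O(1 + h^(p-α+β) + |log h|)` (`exists_abs_integral_slabKernel_sub_le`). Finally `h/c` is the
distance from `x` to the tangent plane, so it differs from `δ(x)` by `O(h^(1+β))`, an error of the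
same order. Hence `γ = β`.

The principal value exists because the linear part of `h(y)^p - h(x)^p` at `x` is odd and integrates
to zero on balls against every even weight. Removing it leaves an absolutely convergent integral,
which is the limit of both the truncated and the regularised integrals
(`tendsto_integral_even_weight`). -/

namespace VerticalDistance

/-! ### Integrals of powers of quadratic forms over `ℝ^n` -/

/-- The integral `∫ (1 + |u|²)^(-m)` over `ℝ^n`. -/
noncomputable def bracketIntegral (n : ℕ) (m : ℝ) : ℝ :=
  ∫ u : EuclideanSpace ℝ (Fin n), (1 + ‖u‖ ^ 2) ^ (-m)

theorem integrable_bracket {n : ℕ} {m : ℝ} (hm : (n : ℝ) / 2 < m) :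
    Integrable (fun u : EuclideanSpace ℝ (Fin n) => (1 + ‖u‖ ^ 2) ^ (-m)) := by
  have := integrable_rpow_neg_one_add_norm_sq (E := EuclideanSpace ℝ (Fin n)) (μ := volume)
    (r := 2 * m) (by simp; linarith)
  convert this using 2
  ring_nf

/-- Writing `(1 + |u|²)^(-m) Γ(m)` as `∫ t^(m-1) e^(-(1+|u|²)t) dt` and exchanging the integrals
leaves a Gaussian in `u` and then a Gamma integral in `t`. -/
theorem bracketIntegral_eq {n : ℕ} {m : ℝ} (hm : (n : ℝ) / 2 < m) :
    bracketIntegral n m = Real.pi ^ ((n : ℝ) / 2) * Real.Gamma (m - n / 2) / Real.Gamma m := by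
  have hn : (0 : ℝ) ≤ n := Nat.cast_nonneg n
  have hm0 : 0 < m := by linarith
  have hΓ := Real.Gamma_pos_of_pos hm0
  set f : EuclideanSpace ℝ (Fin n) → ℝ → ℝ :=
    fun u t => t ^ (m - 1) * Real.exp (-((1 + ‖u‖ ^ 2) * t)) with hf
  have hmeas : Measurable (Function.uncurry f) := by
    simp only [hf, Function.uncurry_def]
    fun_prop
  have hinner : ∀ u, ∫ t in Ioi (0 : ℝ), f u t = (1 + ‖u‖ ^ 2) ^ (-m) * Real.Gamma m := by
    intro u
    rw [hf, Real.integral_rpow_mul_exp_neg_mul_Ioi hm0 (by positivity), one_div,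
      Real.inv_rpow (by positivity), Real.rpow_neg (by positivity)]
  have hnn : ∀ u, ∀ t ∈ Ioi (0 : ℝ), 0 ≤ f u t := fun u t ht =>
    mul_nonneg (Real.rpow_nonneg (le_of_lt ht) _) (Real.exp_pos _).le
  have hint : ∀ u, IntegrableOn (f u) (Ioi 0) := by
    intro u
    by_contra hcon
    have h1 := hinner u
    rw [integral_undef hcon] at h1
    have : 0 < (1 + ‖u‖ ^ 2) ^ (-m) * Real.Gamma m := by positivity
    linarith
  have hprod : Integrable (Function.uncurry f)
      ((volume : Measure (EuclideanSpace ℝ (Fin n))).prod (volume.restrict (Ioi (0 : ℝ)))) := by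
    rw [integrable_prod_iff hmeas.aestronglyMeasurable]
    refine ⟨Eventually.of_forall fun u => hint u, ?_⟩
    refine ((integrable_bracket hm).mul_const (Real.Gamma m)).congr
      (Eventually.of_forall fun u => ?_)
    simp only
    rw [← hinner u]
    refine setIntegral_congr_fun measurableSet_Ioi fun t ht => ?_
    simp [Function.uncurry, abs_of_nonneg (hnn u t ht)]
  have hswap := integral_integral_swap hprod
  have hleft : ∫ u, ∫ t in Ioi (0 : ℝ), f u t = bracketIntegral n m * Real.Gamma m := by
    simp_rw [hinner]
    rw [integral_mul_const]; rfl
  have hright : ∫ t in Ioi (0 : ℝ), ∫ u, f u t =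
      Real.pi ^ ((n : ℝ) / 2) * Real.Gamma (m - n / 2) := by
    rw [Real.Gamma_eq_integral (by linarith), ← integral_const_mul]
    refine setIntegral_congr_fun measurableSet_Ioi fun t ht => ?_
    have ht : 0 < t := ht
    have : ∀ u : EuclideanSpace ℝ (Fin n),
        f u t = (t ^ (m - 1) * Real.exp (-t)) * Real.exp (-t * ‖u‖ ^ 2) := by
      intro u
      simp only [hf]
      rw [mul_assoc, ← Real.exp_add]
      ring_nf
    simp_rw [this]
    rw [integral_const_mul, GaussianFourier.integral_rexp_neg_mul_sq_norm ht,
      Real.div_rpow Real.pi_pos.le ht.le]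
    simp only [finrank_euclideanSpace, Fintype.card_fin]
    rw [show m - n / 2 - 1 = (m - 1) - n / 2 by ring, Real.rpow_sub ht (m - 1) (n / 2)]
    ring
  rw [eq_div_iff hΓ.ne', ← hleft, ← hright]
  exact hswap

theorem sphereArea_eq {n : ℕ} (hn : 1 ≤ n) :
    sphereArea n = 2 * Real.pi ^ ((n : ℝ) / 2) / Real.Gamma ((n : ℝ) / 2) := by
  have : Nonempty (Fin n) := ⟨⟨0, hn⟩⟩
  have hn' : (0 : ℝ) < n := by exact_mod_cast hn
  have hΓ := Real.Gamma_pos_of_pos (half_pos hn')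
  rw [sphereArea, Measure.toSphere_real_apply_univ, measureReal_def, EuclideanSpace.volume_ball]
  simp only [finrank_euclideanSpace, Fintype.card_fin, ENNReal.ofReal_one, one_pow, one_mul]
  rw [ENNReal.toReal_ofReal (by positivity), Real.Gamma_add_one (by positivity),
    Real.sqrt_eq_rpow, ← Real.rpow_natCast, ← Real.rpow_mul Real.pi_pos.le]
  rw [show (1 / 2 : ℝ) * n = n / 2 by ring]
  field_simp

theorem bracketIntegral_eq_sphereArea_mul_beta {n : ℕ} (hn : 1 ≤ n) {α : ℝ} (hα : 0 < α) :
    bracketIntegral n ((n + 1 + α) / 2) =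
      sphereArea n / 2 * ProbabilityTheory.beta ((α + 1) / 2) ((n : ℝ) / 2) := by
  have hn' : (0 : ℝ) < n := by exact_mod_cast hn
  have hΓ := Real.Gamma_pos_of_pos (half_pos hn')
  rw [bracketIntegral_eq (by linarith), sphereArea_eq hn, ProbabilityTheory.beta]
  rw [show ((n : ℝ) + 1 + α) / 2 - n / 2 = (α + 1) / 2 by ring,
    show ((n : ℝ) + 1 + α) / 2 = (α + 1) / 2 + n / 2 by ring]
  field_simp

theorem bracket_scale {n : ℕ} {A : ℝ} (hA : 0 < A) (m : ℝ) (u : EuclideanSpace ℝ (Fin n)) :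
    (‖u‖ ^ 2 + A) ^ (-m) = A ^ (-m) * (1 + ‖(√A)⁻¹ • u‖ ^ 2) ^ (-m) := by
  rw [← Real.mul_rpow hA.le (by positivity), norm_smul, mul_pow, norm_inv, inv_pow,
    Real.norm_of_nonneg (Real.sqrt_nonneg _), Real.sq_sqrt hA.le]
  congr 1
  field_simp
  ring

theorem integrable_norm_sq_add {n : ℕ} {m A : ℝ} (hm : (n : ℝ) / 2 < m) (hA : 0 < A) :
    Integrable (fun u : EuclideanSpace ℝ (Fin n) => (‖u‖ ^ 2 + A) ^ (-m)) := by
  simp_rw [bracket_scale hA]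
  have h : (√A)⁻¹ ≠ 0 := by positivity
  exact (((integrable_comp_smul_iff volume
    (fun u : EuclideanSpace ℝ (Fin n) => (1 + ‖u‖ ^ 2) ^ (-m)) h).2
      (integrable_bracket hm))).const_mul _

theorem integral_norm_sq_add {n : ℕ} {A : ℝ} (hA : 0 < A) (m : ℝ) :
    ∫ u : EuclideanSpace ℝ (Fin n), (‖u‖ ^ 2 + A) ^ (-m) =
      A ^ ((n : ℝ) / 2 - m) * bracketIntegral n m := by
  simp_rw [bracket_scale hA]
  rw [integral_const_mul, Measure.integral_comp_inv_smul volume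
    (fun u : EuclideanSpace ℝ (Fin n) => (1 + ‖u‖ ^ 2) ^ (-m)) (√A), bracketIntegral,
    smul_eq_mul, ← mul_assoc]
  congr 1
  rw [finrank_euclideanSpace, Fintype.card_fin, abs_of_nonneg (by positivity), Real.sqrt_eq_rpow,
    ← Real.rpow_natCast, ← Real.rpow_mul hA.le, ← Real.rpow_add hA]
  ring_nf

/-- The change of variables `u ↦ u + ⟨a, u⟩ a / (1 + √(1 + |a|²))`, whose matrix is the square
root of `1 + a aᵀ`, straightens the quadratic form `|u|² + ⟨a, u⟩²`. -/
theorem integral_comp_slant {n : ℕ} (a : EuclideanSpace ℝ (Fin n)) (f : ℝ → ℝ) :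
    ∫ u : EuclideanSpace ℝ (Fin n), f (‖u‖ ^ 2 + inner ℝ a u ^ 2) =
      (√(1 + ‖a‖ ^ 2))⁻¹ * ∫ u : EuclideanSpace ℝ (Fin n), f (‖u‖ ^ 2) := by
  set c := √(1 + ‖a‖ ^ 2) with hc
  have hcpos : 0 < c := Real.sqrt_pos.2 (by positivity)
  have hc2 : c ^ 2 = 1 + ‖a‖ ^ 2 := Real.sq_sqrt (by positivity)
  set T : EuclideanSpace ℝ (Fin n) →ₗ[ℝ] EuclideanSpace ℝ (Fin n) :=
    LinearMap.transvection (innerₛₗ ℝ a) ((1 + c)⁻¹ • a) with hT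
  have hTa : ∀ u, T u = u + inner ℝ a u • ((1 + c)⁻¹ • a) := fun u => by
    simp [hT, LinearMap.transvection.apply]
  -- By the rank-one formula, `det T = 1 + |a|²/(1 + c) = 1 + (c² - 1)/(1 + c) = c`.
  have hdet : LinearMap.det T = c := by
    rw [hT, LinearMap.transvection.det]
    simp only [innerₛₗ_apply_apply, inner_smul_right, real_inner_self_eq_norm_sq]
    field_simp
    nlinarith
  have hnorm : ∀ u, ‖T u‖ ^ 2 = ‖u‖ ^ 2 + inner ℝ a u ^ 2 := by
    intro u
    rw [hTa, norm_add_sq_real, norm_smul, norm_smul, inner_smul_right, inner_smul_right,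
      real_inner_comm, mul_pow, mul_pow, Real.norm_eq_abs, Real.norm_eq_abs, sq_abs, sq_abs]
    have h1 : ‖a‖ ^ 2 = c ^ 2 - 1 := by linarith
    rw [h1]
    field_simp
    ring
  have hmap := Measure.map_linearMap_addHaar_eq_smul_addHaar
    (volume : Measure (EuclideanSpace ℝ (Fin n))) (f := T) (by rw [hdet]; exact hcpos.ne')
  have hTe : MeasurableEmbedding T := by
    have he : IsUnit (LinearMap.det T) := by rw [hdet]; exact hcpos.ne'.isUnit
    have := (LinearEquiv.ofIsUnitDet (f := T) (v := Module.finBasis ℝ _)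
      (v' := Module.finBasis ℝ _) (by rwa [LinearMap.det_toMatrix])).toContinuousLinearEquiv
      |>.toHomeomorph.measurableEmbedding
    exact this
  have h2 := hTe.integral_map (μ := volume) (fun u => f (‖u‖ ^ 2))
  rw [hmap, integral_smul_measure, hdet] at h2
  simp_rw [hnorm] at h2
  rw [← h2, ENNReal.toReal_ofReal (abs_nonneg _), abs_of_pos (inv_pos.2 hcpos), smul_eq_mul]

theorem integral_slanted_kernel {n : ℕ} (a : EuclideanSpace ℝ (Fin n)) (m s : ℝ) {η : ℝ}
    (hη : 0 < η) :
    ∫ u : EuclideanSpace ℝ (Fin n), (‖u‖ ^ 2 + (s + inner ℝ a u) ^ 2 + η ^ 2) ^ (-m) =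
      (√(1 + ‖a‖ ^ 2))⁻¹ * bracketIntegral n m *
        (s ^ 2 / (1 + ‖a‖ ^ 2) + η ^ 2) ^ ((n : ℝ) / 2 - m) := by
  have hpos : 0 < 1 + ‖a‖ ^ 2 := by positivity
  -- This translation completes the square: it removes the term linear in `u` and leaves the squared
  -- distance `s²/(1 + |a|²)` to the plane.
  rw [← integral_sub_right_eq_self _ ((s / (1 + ‖a‖ ^ 2)) • a)]
  have : ∀ w : EuclideanSpace ℝ (Fin n),
      ‖w - (s / (1 + ‖a‖ ^ 2)) • a‖ ^ 2 +
        (s + inner ℝ a (w - (s / (1 + ‖a‖ ^ 2)) • a)) ^ 2 + η ^ 2 =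
      (‖w‖ ^ 2 + inner ℝ a w ^ 2) + (s ^ 2 / (1 + ‖a‖ ^ 2) + η ^ 2) := by
    intro w
    rw [norm_sub_sq_real, inner_sub_right, inner_smul_right, inner_smul_right,
      real_inner_self_eq_norm_sq, norm_smul, mul_pow, Real.norm_eq_abs, sq_abs,
      real_inner_comm a w]
    field_simp
    ring
  simp_rw [this]
  rw [integral_comp_slant a (fun r => (r + (s ^ 2 / (1 + ‖a‖ ^ 2) + η ^ 2)) ^ (-m)),
    integral_norm_sq_add (by positivity)]
  ring

/-! ### Differences of negative powers -/

/-- Tangent-line bound for the convex function `x ↦ x^(-m)`, from `e^y ≥ 1 + y` and `log x ≤ x - 1`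
at `x = B / A`. -/
theorem rpow_neg_sub_rpow_neg_le {A B m : ℝ} (hA : 0 < A) (hAB : A ≤ B) (hm : 0 ≤ m) :
    A ^ (-m) - B ^ (-m) ≤ m * A ^ (-m - 1) * (B - A) := by
  have hB : 0 < B := hA.trans_le hAB
  have hx : 0 < B / A := by positivity
  have h1 : 1 - m * (B / A - 1) ≤ (B / A) ^ (-m) := by
    rw [Real.rpow_def_of_pos hx]
    have h2 := Real.add_one_le_exp (Real.log (B / A) * -m)
    have h3 := mul_le_mul_of_nonneg_left (Real.log_le_sub_one_of_pos hx) hm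
    linarith
  have h4 : B ^ (-m) = A ^ (-m) * (B / A) ^ (-m) := by
    rw [← Real.mul_rpow hA.le hx.le]
    congr 1
    field_simp
  have h5 : A ^ (-m - 1) = A ^ (-m) / A := by rw [Real.rpow_sub_one hA.ne']
  have h6 := mul_le_mul_of_nonneg_left h1 (Real.rpow_pos_of_pos hA (-m)).le
  rw [h4, h5]
  calc A ^ (-m) - A ^ (-m) * (B / A) ^ (-m) ≤ A ^ (-m) - A ^ (-m) * (1 - m * (B / A - 1)) := by
        linarith
    _ = m * (A ^ (-m) / A) * (B - A) := by field_simp; ring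

theorem abs_rpow_neg_sub_rpow_neg_le {A B c m : ℝ} (hc : 0 < c) (hA : c ≤ A) (hB : c ≤ B)
    (hm : 0 ≤ m) : |A ^ (-m) - B ^ (-m)| ≤ m * c ^ (-m - 1) * |A - B| := by
  have key : ∀ A B : ℝ, c ≤ A → A ≤ B →
      |A ^ (-m) - B ^ (-m)| ≤ m * c ^ (-m - 1) * |A - B| := by
    intro A B hA hAB
    have hA0 := hc.trans_le hA
    have h1 : B ^ (-m) ≤ A ^ (-m) := Real.rpow_le_rpow_of_nonpos hA0 hAB (by linarith)
    rw [abs_of_nonneg (by linarith), abs_sub_comm, abs_of_nonneg (by linarith)]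
    refine (rpow_neg_sub_rpow_neg_le hA0 hAB hm).trans ?_
    have h2 : A ^ (-m - 1) ≤ c ^ (-m - 1) := Real.rpow_le_rpow_of_nonpos hc hA (by linarith)
    have : 0 ≤ B - A := by linarith
    gcongr
  rcases le_total A B with h | h
  · exact key A B hA h
  · rw [abs_sub_comm, abs_sub_comm A B]
    exact key B A hB h

/-! ### The one-dimensional principal value and `gammaConst` -/

theorem integrableOn_profile {α p h η : ℝ} (hp : 0 < p) (hpα : p < α)
    (hh : 0 < h) (hη : 0 < η) :
    IntegrableOn (fun t : ℝ => (t ^ p + h ^ p) * ((t - h) ^ 2 + η ^ 2) ^ (-((1 + α) / 2)))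
      (Ioi 0) := by
  have hpos : ∀ t : ℝ, (t - h) ^ 2 + η ^ 2 ≠ 0 := fun t => by positivity
  have hcont : Continuous
      (fun t : ℝ => (t ^ p + h ^ p) * ((t - h) ^ 2 + η ^ 2) ^ (-((1 + α) / 2))) := by
    refine ((Real.continuous_rpow_const hp.le).add continuous_const).mul ?_
    exact (Continuous.rpow_const (by fun_prop) fun t => Or.inl (hpos t))
  rw [← Ioc_union_Ioi_eq_Ioi (show (0 : ℝ) ≤ 2 * h by positivity)]
  refine IntegrableOn.union ?_ ?_
  · exact (hcont.continuousOn.integrableOn_Icc (a := 0) (b := 2 * h)).mono_set Ioc_subset_Icc_self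
  · have h2 : (0 : ℝ) < 2 * h := by positivity
    refine Integrable.mono' (((integrableOn_Ioi_rpow_of_lt (a := p - 1 - α) (by linarith)
      h2).const_mul (2 * 4 ^ ((1 + α) / 2)))) hcont.aestronglyMeasurable ?_
    refine (ae_restrict_mem measurableSet_Ioi).mono fun t ht => ?_
    have ht : 2 * h < t := ht
    have ht0 : 0 < t := h2.trans ht
    rw [Real.norm_of_nonneg (by positivity)]
    have h3 : h ^ p ≤ t ^ p := Real.rpow_le_rpow hh.le (by linarith) hp.le
    have h4 : ((t - h) ^ 2 + η ^ 2) ^ (-((1 + α) / 2)) ≤ (t ^ 2 / 4) ^ (-((1 + α) / 2)) := by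
      refine Real.rpow_le_rpow_of_nonpos (by positivity) ?_ (by linarith)
      nlinarith
    have h5 : (t ^ 2 / 4) ^ (-((1 + α) / 2)) = 4 ^ ((1 + α) / 2) * t ^ (-(1 + α)) := by
      rw [Real.div_rpow (by positivity) (by norm_num), Real.rpow_neg (by norm_num : (0:ℝ) ≤ 4),
        div_inv_eq_mul, ← Real.rpow_natCast, ← Real.rpow_mul ht0.le, mul_comm]
      congr 2
      push_cast; ring
    calc (t ^ p + h ^ p) * ((t - h) ^ 2 + η ^ 2) ^ (-((1 + α) / 2))
        ≤ (t ^ p + t ^ p) * (4 ^ ((1 + α) / 2) * t ^ (-(1 + α))) := by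
          rw [← h5]; gcongr
      _ = 2 * 4 ^ ((1 + α) / 2) * (t ^ p * t ^ (-(1 + α))) := by ring
      _ = 2 * 4 ^ ((1 + α) / 2) * t ^ (p - 1 - α) := by
          rw [← Real.rpow_add ht0]; ring_nf

/-- The regularised integrand of `gammaConst` obtained by folding `(1, ∞)` onto `(0, 1)`. -/
noncomputable def foldedProfile (α p η σ : ℝ) : ℝ :=
  (σ ^ p - 1) * ((σ - 1) ^ 2 + η ^ 2) ^ (-((1 + α) / 2)) +
    (1 - σ ^ p) * σ ^ (α - p - 1) * ((1 - σ) ^ 2 + η ^ 2 * σ ^ 2) ^ (-((1 + α) / 2))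

theorem folded_tail_eq {α p η σ : ℝ} (hσ : 0 < σ) :
    |(-(σ ^ 2)⁻¹)| • (((σ⁻¹) ^ p - 1) * ((σ⁻¹ - 1) ^ 2 + η ^ 2) ^ (-((1 + α) / 2))) =
      (1 - σ ^ p) * σ ^ (α - p - 1) * ((1 - σ) ^ 2 + η ^ 2 * σ ^ 2) ^ (-((1 + α) / 2)) := by
  have h1 : (σ⁻¹ - 1) ^ 2 + η ^ 2 = ((1 - σ) ^ 2 + η ^ 2 * σ ^ 2) * (σ ^ 2)⁻¹ := by
    field_simp
  have h2 : ((σ ^ 2)⁻¹) ^ (-((1 + α) / 2)) = σ ^ (1 + α) := by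
    rw [Real.inv_rpow (by positivity), Real.rpow_neg (by positivity), inv_inv,
      ← Real.rpow_natCast, ← Real.rpow_mul hσ.le]
    congr 1; push_cast; ring
  have h3 : σ ^ (α - p - 1) = σ ^ (1 + α) * (σ ^ p)⁻¹ * (σ ^ 2)⁻¹ := by
    rw [← Real.rpow_neg hσ.le, ← Real.rpow_natCast σ 2, ← Real.rpow_neg hσ.le,
      ← Real.rpow_add hσ, ← Real.rpow_add hσ]
    congr 1; push_cast; ring
  have hp := (Real.rpow_pos_of_pos hσ p).ne'
  rw [h1, Real.mul_rpow (by positivity) (by positivity), h2, abs_neg,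
    abs_of_pos (by positivity), Real.inv_rpow hσ.le, h3, smul_eq_mul]
  field_simp

/-- Splitting at `t = 1` and substituting `t = 1/σ` on `(1, ∞)` is legitimate because `η > 0` makes
both halves integrable; at `η = 0` each half diverges when `α ≥ 1`, and only the folded sum
survives. -/
theorem integral_profile_eq_folded {α p η : ℝ} (hp : 0 < p) (hpα : p < α)
    (hη : 0 < η) :
    ∫ t in Ioi (0 : ℝ), (t ^ p - 1) * ((t - 1) ^ 2 + η ^ 2) ^ (-((1 + α) / 2)) =
      ∫ σ in Ioo (0 : ℝ) 1, foldedProfile α p η σ := by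
  set f : ℝ → ℝ := fun t => (t ^ p - 1) * ((t - 1) ^ 2 + η ^ 2) ^ (-((1 + α) / 2)) with hf
  have hint : IntegrableOn f (Ioi 0) := by
    have := integrableOn_profile hp hpα one_pos hη
    refine Integrable.mono' this (by fun_prop) ?_
    refine (ae_restrict_mem measurableSet_Ioi).mono fun t ht => ?_
    have ht : 0 < t := ht
    have h1 : 0 < t ^ p := Real.rpow_pos_of_pos ht p
    simp only [hf]
    rw [norm_mul, Real.norm_of_nonneg (by positivity : 0 ≤ ((t - 1) ^ 2 + η ^ 2) ^ (-((1 + α) / 2)))]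
    gcongr
    rw [Real.norm_eq_abs, Real.one_rpow, abs_le]
    constructor <;> linarith
  have himg : (fun σ : ℝ => σ⁻¹) '' Ioo 0 1 = Ioi 1 := by
    ext t
    simp only [mem_image, mem_Ioo, mem_Ioi]
    constructor
    · rintro ⟨σ, ⟨h0, h1⟩, rfl⟩
      exact (one_lt_inv₀ h0).2 h1
    · intro ht
      exact ⟨t⁻¹, ⟨by positivity, inv_lt_one_of_one_lt₀ ht⟩, inv_inv t⟩
  have hder : ∀ σ ∈ Ioo (0 : ℝ) 1,
      HasDerivWithinAt (fun σ : ℝ => σ⁻¹) (-(σ ^ 2)⁻¹) (Ioo 0 1) σ := fun σ hσ =>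
    (hasDerivAt_inv hσ.1.ne').hasDerivWithinAt
  have hinj : InjOn (fun σ : ℝ => σ⁻¹) (Ioo 0 1) := fun a _ b _ h => inv_injective h
  have h1 := integral_image_eq_integral_abs_deriv_smul measurableSet_Ioo hder hinj f
  have h2 := integrableOn_image_iff_integrableOn_abs_deriv_smul measurableSet_Ioo hder hinj f
  rw [himg] at h1 h2
  rw [← Ioc_union_Ioi_eq_Ioi (zero_le_one' ℝ), setIntegral_union Ioc_disjoint_Ioi_same
    measurableSet_Ioi (hint.mono_set Ioc_subset_Ioi_self)
    (hint.mono_set (Ioi_subset_Ioi zero_le_one)), integral_Ioc_eq_integral_Ioo, h1,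
    ← integral_add (hint.mono_set fun x hx => hx.1)
      (h2.1 (hint.mono_set (Ioi_subset_Ioi zero_le_one)))]
  refine setIntegral_congr_fun measurableSet_Ioo fun σ hσ => ?_
  simp only [hf, foldedProfile]
  rw [folded_tail_eq hσ.1]

theorem abs_rpow_sub_one_le {e σ : ℝ} (he : |e| ≤ 1) (h0 : 0 < σ) (h1 : σ < 1) :
    |σ ^ e - 1| ≤ (1 - σ) / σ := by
  obtain ⟨he1, he2⟩ := abs_le.1 he
  have h2 : σ ≤ σ ^ e := by
    simpa using Real.rpow_le_rpow_of_exponent_ge h0 h1.le he2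
  have h3 : σ ^ e ≤ σ⁻¹ := by
    have := Real.rpow_le_rpow_of_exponent_ge h0 h1.le he1
    rwa [Real.rpow_neg_one] at this
  have h4 : (1 - σ) / σ = σ⁻¹ - 1 := by field_simp
  have h5 : σ + σ⁻¹ ≥ 2 := by
    have : σ + σ⁻¹ - 2 = (σ - 1) ^ 2 / σ := by field_simp; ring
    have : 0 ≤ (σ - 1) ^ 2 / σ := by positivity
    linarith
  rw [h4, abs_le]
  constructor <;> linarith

-- A majorant independent of `η`. With `w = 1 - σ` and `q = σ^(α-p-1)`, the folded integrand is `(1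
-- - σ^p)((q - 1)X + (X - Y))`. Here `1 - σ^p` is `O(w)`, `q - 1` is `O(w(q + 1))`, `X ≤ w^(-1-α)`
-- and `X - Y = O(w^(-α))`, so near `σ = 1` the product is `O(w^(1-α))`, integrable for `α < 2`;
-- near `0` it is `O(q + 1)`, integrable for `p < α`.
set_option maxHeartbeats 400000 in
theorem abs_foldedProfile_le {α p η σ : ℝ} (hα : 0 < α) (hα2 : α < 2) (hp : 0 < p) (hpα : p < α)
    (h0 : 0 < σ) (h1 : σ < 1) :
    |foldedProfile α p η σ| ≤ 40 * (2 * σ ^ (α - p - 1) + 2 + 3 * (1 - σ) ^ (1 - α)) := by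
  set w := 1 - σ with hw
  have hw0 : 0 < w := by linarith
  set q := σ ^ (α - p - 1) with hq
  have hq0 : 0 < q := Real.rpow_pos_of_pos h0 _
  set μ := (1 + α) / 2 with hμ
  set X := (w ^ 2 + η ^ 2 * σ ^ 2) ^ (-μ) with hX
  set Y := (w ^ 2 + η ^ 2) ^ (-μ) with hY
  have hσp : σ ^ p ≤ 1 := Real.rpow_le_one h0.le h1.le hp.le
  have hP : 1 - σ ^ p ≤ 2 * w := by
    have := Real.rpow_le_rpow_of_exponent_ge h0 h1.le (show p ≤ 2 by linarith)
    rw [Real.rpow_two] at this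
    nlinarith
  have hXw : X ≤ w ^ (-(1 + α)) := by
    have : w ^ (-(1 + α)) = (w ^ 2) ^ (-μ) := by
      rw [← Real.rpow_natCast, ← Real.rpow_mul hw0.le]
      congr 1; push_cast; rw [hμ]; ring
    rw [this]
    exact Real.rpow_le_rpow_of_nonpos (by positivity) (by nlinarith [sq_nonneg (η * σ)])
      (by linarith)
  have hX0 : 0 ≤ X := by positivity
  have hY0 : 0 ≤ Y := by positivity
  have hσ2 : σ ^ 2 ≤ 1 := by nlinarith
  have hYX : Y ≤ X := Real.rpow_le_rpow_of_nonpos (by positivity)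
    (by nlinarith [sq_nonneg η]) (by linarith)
  have hwα : w ^ (-(1 + α)) = w ^ (-α) / w := by
    rw [← Real.rpow_sub_one hw0.ne']; ring_nf
  have hwα' : w ^ (1 - α) = w ^ (-α) * w := by
    rw [← Real.rpow_add_one hw0.ne']; ring_nf
  have hwα0 : 0 < w ^ (-α) := Real.rpow_pos_of_pos hw0 _
  have hXY : X - Y ≤ 14 * w ^ (-α) := by
    rcases le_total σ (1 / 2) with hs | hs
    · have : w ^ (-α) / w ≤ 2 * w ^ (-α) := by
        rw [div_le_iff₀ hw0]; nlinarith
      linarith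
    -- For `σ ≥ 1/2` the two bases differ by `η²(1 - σ²)`, at most `8w` times the smaller base, so
    -- the tangent-line bound gains a factor `w` over `X`.
    · have hA : 0 < w ^ 2 + η ^ 2 * σ ^ 2 := by positivity
      have h3 := rpow_neg_sub_rpow_neg_le (m := μ) hA
        (show w ^ 2 + η ^ 2 * σ ^ 2 ≤ w ^ 2 + η ^ 2 by nlinarith [sq_nonneg η]) (by linarith)
      rw [Real.rpow_sub_one hA.ne'] at h3
      refine h3.trans ?_
      have h4 : w ^ 2 + η ^ 2 - (w ^ 2 + η ^ 2 * σ ^ 2) ≤ 8 * w * (w ^ 2 + η ^ 2 * σ ^ 2) := by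
        have h41 : 1 - σ ^ 2 ≤ 2 * w := by nlinarith
        have h42 : 1 ≤ 4 * σ ^ 2 := by nlinarith
        have h43 : η ^ 2 * (1 - σ ^ 2) ≤ η ^ 2 * (2 * w) := by gcongr
        have h44 : η ^ 2 * (2 * w) ≤ η ^ 2 * (2 * w) * (4 * σ ^ 2) := by
          apply le_mul_of_one_le_right (by positivity) h42
        nlinarith [pow_pos hw0 3]
      calc μ * (X / (w ^ 2 + η ^ 2 * σ ^ 2)) * (w ^ 2 + η ^ 2 - (w ^ 2 + η ^ 2 * σ ^ 2))
          ≤ μ * (X / (w ^ 2 + η ^ 2 * σ ^ 2)) * (8 * w * (w ^ 2 + η ^ 2 * σ ^ 2)) := by gcongr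
        _ = 8 * μ * (X * w) := by field_simp
        _ ≤ 8 * μ * (w ^ (-(1 + α)) * w) := by gcongr
        _ = 8 * μ * w ^ (-α) := by rw [hwα]; field_simp
        _ ≤ 14 * w ^ (-α) := by gcongr; linarith
  have hq1 : |q - 1| ≤ 2 * w * (q + 1) := by
    rcases le_total σ (1 / 2) with hs | hs
    · have h5 : |q - 1| ≤ q + 1 := by rw [abs_le]; constructor <;> linarith
      nlinarith
    · have h5 := abs_rpow_sub_one_le (e := α - p - 1) (by rw [abs_le]; constructor <;> linarith) h0 h1
      have h6 : (1 - σ) / σ ≤ 2 * w := by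
        rw [div_le_iff₀ h0]; nlinarith
      have h7 := mul_le_mul_of_nonneg_left (by linarith : 1 ≤ q + 1) (by linarith : 0 ≤ 2 * w)
      linarith
  -- The two singularities decouple: `w^(1-α) ≤ 2` on the left half of the interval and `q ≤ 2` on
  -- the right half.
  have hfin : (q + 1) * w ^ (1 - α) ≤ 2 * q + 2 + 3 * w ^ (1 - α) := by
    have hw1 : w ≤ 1 := by linarith
    have hww : 0 < w ^ (1 - α) := Real.rpow_pos_of_pos hw0 _
    rcases le_total σ (1 / 2) with hs | hs
    · have : w ^ (1 - α) ≤ 2 := by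
        have h7 := Real.rpow_le_rpow_of_exponent_ge hw0 hw1 (show -1 ≤ 1 - α by linarith)
        rw [Real.rpow_neg_one] at h7
        refine h7.trans ?_
        rw [inv_le_comm₀ hw0 (by norm_num)]
        linarith
      have h8 := mul_le_mul_of_nonneg_left this (by linarith : 0 ≤ q + 1)
      linarith
    · have : q ≤ 2 := by
        have h7 := Real.rpow_le_rpow_of_exponent_ge h0 h1.le (show -1 ≤ α - p - 1 by linarith)
        rw [Real.rpow_neg_one] at h7
        refine h7.trans ?_
        rw [inv_le_comm₀ h0 (by norm_num)]
        linarith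
      have h8 := mul_le_mul_of_nonneg_right this hww.le
      linarith
  have heq : foldedProfile α p η σ = (1 - σ ^ p) * ((q - 1) * X + (X - Y)) := by
    simp only [foldedProfile]
    rw [show (σ - 1) ^ 2 = w ^ 2 by rw [hw]; ring]
    ring
  rw [heq, abs_mul, abs_of_nonneg (by linarith)]
  calc (1 - σ ^ p) * |(q - 1) * X + (X - Y)|
      ≤ 2 * w * (2 * w * (q + 1) * w ^ (-(1 + α)) + 14 * w ^ (-α)) := by
        gcongr
        refine (abs_add_le _ _).trans ?_
        rw [abs_mul, abs_of_nonneg hX0, abs_of_nonneg (show 0 ≤ X - Y by linarith)]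
        gcongr
    _ = (4 * q + 32) * w ^ (1 - α) := by
        rw [hwα, hwα']; field_simp; ring
    _ ≤ 40 * ((q + 1) * w ^ (1 - α)) := by
        have : 0 < w ^ (1 - α) := Real.rpow_pos_of_pos hw0 _
        nlinarith [mul_pos hq0 this]
    _ ≤ _ := by gcongr

theorem tendsto_integral_profile {α p : ℝ} (hα : 0 < α) (hα2 : α < 2) (hp : 0 < p)
    (hpα : p < α) :
    Tendsto (fun η : ℝ =>
      ∫ t in Ioi (0 : ℝ), (t ^ p - 1) * ((t - 1) ^ 2 + η ^ 2) ^ (-((1 + α) / 2)))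
      (𝓝[>] 0) (𝓝 (gammaConst α p)) := by
  have h1 : gammaConst α p = ∫ σ in Ioo (0 : ℝ) 1, foldedProfile α p 0 σ := by
    rw [gammaConst, intervalIntegral.integral_of_le zero_le_one, integral_Ioc_eq_integral_Ioo]
    refine setIntegral_congr_fun measurableSet_Ioo fun σ hσ => ?_
    have hw0 : 0 < 1 - σ := by linarith [hσ.2]
    have h2 : ((1 - σ) ^ 2) ^ (-((1 + α) / 2)) = ((1 - σ) ^ (1 + α))⁻¹ := by
      rw [← Real.rpow_natCast, ← Real.rpow_mul hw0.le, ← Real.rpow_neg hw0.le]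
      congr 1; push_cast; ring
    simp only [foldedProfile]
    rw [show (σ - 1) ^ 2 + 0 ^ 2 = (1 - σ) ^ 2 by ring,
      show (1 - σ) ^ 2 + 0 ^ 2 * σ ^ 2 = (1 - σ) ^ 2 by ring, h2]
    field_simp
    ring
  rw [h1]
  have h3 : (fun η : ℝ =>
      ∫ t in Ioi (0 : ℝ), (t ^ p - 1) * ((t - 1) ^ 2 + η ^ 2) ^ (-((1 + α) / 2))) =ᶠ[𝓝[>] 0]
      fun η => ∫ σ in Ioo (0 : ℝ) 1, foldedProfile α p η σ := by
    filter_upwards [self_mem_nhdsWithin] with η hη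
    exact integral_profile_eq_folded hp hpα hη
  refine Tendsto.congr' h3.symm ?_
  refine tendsto_integral_filter_of_dominated_convergence
    (fun σ => 40 * (2 * σ ^ (α - p - 1) + 2 + 3 * (1 - σ) ^ (1 - α))) ?_ ?_ ?_ ?_
  · refine Eventually.of_forall fun η => Measurable.aestronglyMeasurable ?_
    unfold foldedProfile
    fun_prop
  · refine Eventually.of_forall fun η => (ae_restrict_mem measurableSet_Ioo).mono fun σ hσ => ?_
    exact abs_foldedProfile_le hα hα2 hp hpα hσ.1 hσ.2
  · have ha : IntegrableOn (fun σ : ℝ => σ ^ (α - p - 1)) (Ioo 0 1) :=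
      (intervalIntegral.integrableOn_Ioo_rpow_iff one_pos).2 (by linarith)
    have hb : IntegrableOn (fun σ : ℝ => (1 - σ) ^ (1 - α)) (Ioo 0 1) := by
      have h5 : IntervalIntegrable (fun σ : ℝ => σ ^ (1 - α)) volume 0 1 :=
        intervalIntegral.intervalIntegrable_rpow' (by linarith)
      have h6 := (h5.comp_sub_left 1).symm
      simp only [sub_zero, sub_self] at h6
      rw [intervalIntegrable_iff_integrableOn_Ioo_of_le zero_le_one] at h6
      exact h6
    have hc : IntegrableOn (fun _ : ℝ => (2 : ℝ)) (Ioo 0 1) := by simp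
    exact (((ha.const_mul 2).add hc).add (hb.const_mul 3)).const_mul 40
  · refine (ae_restrict_mem measurableSet_Ioo).mono fun σ hσ => ?_
    have hw0 : 0 < 1 - σ := by linarith [hσ.2]
    have hcont : ContinuousAt (fun η => foldedProfile α p η σ) 0 := by
      unfold foldedProfile
      refine ContinuousAt.add (ContinuousAt.mul continuousAt_const ?_)
        (ContinuousAt.mul continuousAt_const ?_)
      · refine ContinuousAt.rpow_const (by fun_prop) (Or.inl ?_)
        nlinarith [sq_pos_of_pos hw0]
      · refine ContinuousAt.rpow_const (by fun_prop) (Or.inl ?_)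
        nlinarith [sq_pos_of_pos hw0]
    exact hcont.tendsto.mono_left nhdsWithin_le_nhds

/-- The substitution `t ↦ h t` reduces to `h = c = 1` with regularisation parameter `c η / h`, which
still tends to `0` from above. -/
theorem tendsto_integral_scaled_profile {α p c h : ℝ} (hα : 0 < α) (hα2 : α < 2) (hp : 0 < p)
    (hpα : p < α) (hc : 0 < c) (hh : 0 < h) :
    Tendsto (fun η : ℝ =>
      ∫ t in Ioi (0 : ℝ), (t ^ p - h ^ p) * ((t - h) ^ 2 / c ^ 2 + η ^ 2) ^ (-((1 + α) / 2)))
      (𝓝[>] 0) (𝓝 (c ^ (1 + α) * h ^ (p - α) * gammaConst α p)) := by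
  have hscale : ∀ η : ℝ,
      ∫ t in Ioi (0 : ℝ), (t ^ p - h ^ p) * ((t - h) ^ 2 / c ^ 2 + η ^ 2) ^ (-((1 + α) / 2)) =
      c ^ (1 + α) * h ^ (p - α) *
        ∫ t in Ioi (0 : ℝ), (t ^ p - 1) * ((t - 1) ^ 2 + (c / h * η) ^ 2) ^ (-((1 + α) / 2)) := by
    intro η
    have h1 := integral_comp_mul_left_Ioi'
      (fun t : ℝ => (t ^ p - h ^ p) * ((t - h) ^ 2 / c ^ 2 + η ^ 2) ^ (-((1 + α) / 2))) 0 hh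
    rw [mul_zero] at h1
    rw [← h1, smul_eq_mul, ← integral_const_mul, ← integral_const_mul]
    refine setIntegral_congr_fun measurableSet_Ioi fun t ht => ?_
    have ht : 0 < t := ht
    have h2 : (h * t - h) ^ 2 / c ^ 2 + η ^ 2 =
        (h / c) ^ 2 * ((t - 1) ^ 2 + (c / h * η) ^ 2) := by
      field_simp
    have h3 : ((h / c) ^ 2) ^ (-((1 + α) / 2)) = c ^ (1 + α) * h ^ (-1 - α) := by
      rw [← Real.rpow_natCast, ← Real.rpow_mul (by positivity),
        show ((2 : ℕ) : ℝ) * -((1 + α) / 2) = -(1 + α) by push_cast; ring,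
        Real.div_rpow hh.le hc.le, Real.rpow_neg hc.le, div_inv_eq_mul, mul_comm]
      ring_nf
    have h4 : h ^ (p - α) = h * h ^ p * h ^ (-1 - α) := by
      rw [← Real.rpow_one_add' hh.le (by linarith), ← Real.rpow_add hh]
      ring_nf
    rw [h2, Real.mul_rpow hh.le ht.le, Real.mul_rpow (sq_nonneg (h / c)) (by positivity), h3, h4]
    ring
  simp_rw [hscale]
  refine ((tendsto_integral_profile hα hα2 hp hpα).comp ?_).const_mul _
  refine tendsto_nhdsWithin_iff.2 ⟨?_, ?_⟩
  · have : Tendsto (fun η : ℝ => c / h * η) (𝓝 0) (𝓝 (c / h * 0)) :=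
      (continuous_const.mul continuous_id).tendsto 0
    rw [mul_zero] at this
    exact this.mono_left nhdsWithin_le_nhds
  · filter_upwards [self_mem_nhdsWithin] with η hη
    have : 0 < η := hη
    exact mem_Ioi.2 (by positivity)

/-! ### Slab kernels: size and stability -/

/-- The regularised kernel `(|u|² + (s + φ(u))² + η²)^(-m)` integrated over `u`. -/
noncomputable def slabKernel {n : ℕ} (φ : EuclideanSpace ℝ (Fin n) → ℝ) (m η s : ℝ) : ℝ :=
  ∫ u, (‖u‖ ^ 2 + (s + φ u) ^ 2 + η ^ 2) ^ (-m)

section Kernel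

variable {n : ℕ} {φ ψ : EuclideanSpace ℝ (Fin n) → ℝ} {Λ m : ℝ}

/-- Flattening a Lipschitz graph distorts distances by a bounded factor, from `s² ≤ 2(s + f)² +
2f²`. It allows every slanted kernel to be compared with the flat one. -/
theorem sq_add_sq_le_slanted {a s f : ℝ} (hf : |f| ≤ Λ * a) :
    a ^ 2 + s ^ 2 ≤ (2 + 2 * Λ ^ 2) * (a ^ 2 + (s + f) ^ 2) := by
  have h1 : f ^ 2 ≤ (Λ * a) ^ 2 := sq_le_sq' (by linarith [neg_abs_le f]) ((le_abs_self f).trans hf)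
  nlinarith [sq_nonneg (s + 2 * f), sq_nonneg (Λ * (s + f)), sq_nonneg a]

theorem slanted_kernel_le (hm : 0 ≤ m) (hφ : ∀ u, |φ u| ≤ Λ * ‖u‖) {η : ℝ} (hη : 0 < η) (s : ℝ)
    (u : EuclideanSpace ℝ (Fin n)) :
    (‖u‖ ^ 2 + (s + φ u) ^ 2 + η ^ 2) ^ (-m) ≤
      (2 + 2 * Λ ^ 2) ^ m * (‖u‖ ^ 2 + (s ^ 2 + η ^ 2)) ^ (-m) := by
  have h1 := sq_add_sq_le_slanted (s := s) (hφ u)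
  have hM : (0 : ℝ) < 2 + 2 * Λ ^ 2 := by positivity
  have h2 : (2 + 2 * Λ ^ 2) ^ m = ((2 + 2 * Λ ^ 2)⁻¹) ^ (-m) := by
    rw [Real.inv_rpow hM.le, Real.rpow_neg hM.le, inv_inv]
  rw [h2, ← Real.mul_rpow (by positivity) (by positivity)]
  refine Real.rpow_le_rpow_of_nonpos (by positivity) ?_ (by linarith)
  rw [inv_mul_le_iff₀ hM]
  nlinarith [sq_nonneg η, sq_nonneg (Λ * η)]

theorem continuous_slanted_kernel (hφc : Continuous φ) {η : ℝ} (hη : 0 < η) :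
    Continuous fun q : EuclideanSpace ℝ (Fin n) × ℝ =>
      (‖q.1‖ ^ 2 + (q.2 + φ q.1) ^ 2 + η ^ 2) ^ (-m) :=
  Continuous.rpow_const (by fun_prop) fun q => Or.inl (by positivity)

theorem integrable_slanted_kernel (hm : (n : ℝ) / 2 < m) (hφc : Continuous φ)
    (hφ : ∀ u, |φ u| ≤ Λ * ‖u‖) {η : ℝ} (hη : 0 < η) (s : ℝ) :
    Integrable fun u => (‖u‖ ^ 2 + (s + φ u) ^ 2 + η ^ 2) ^ (-m) := by
  have hm0 : 0 ≤ m := by have : (0 : ℝ) ≤ n := n.cast_nonneg; linarith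
  refine Integrable.mono' ((integrable_norm_sq_add hm
    (show 0 < s ^ 2 + η ^ 2 by positivity)).const_mul ((2 + 2 * Λ ^ 2) ^ m)) ?_ ?_
  · exact ((continuous_slanted_kernel hφc hη).comp
      (continuous_id.prodMk continuous_const : Continuous fun u => (u, s))).aestronglyMeasurable
  · refine Eventually.of_forall fun u => ?_
    rw [Real.norm_of_nonneg (by positivity)]
    exact slanted_kernel_le hm0 hφ hη s u

theorem slabKernel_nonneg (η s : ℝ) : 0 ≤ slabKernel φ m η s :=
  integral_nonneg fun _ => by positivity

theorem slabKernel_le (hm : (n : ℝ) / 2 < m) (hφc : Continuous φ)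
    (hφ : ∀ u, |φ u| ≤ Λ * ‖u‖) {η : ℝ} (hη : 0 < η) (s : ℝ) :
    slabKernel φ m η s ≤
      (2 + 2 * Λ ^ 2) ^ m * bracketIntegral n m * (s ^ 2 + η ^ 2) ^ ((n : ℝ) / 2 - m) := by
  have hm0 : 0 ≤ m := by have : (0 : ℝ) ≤ n := n.cast_nonneg; linarith
  have hA : 0 < s ^ 2 + η ^ 2 := by positivity
  have h1 := integral_mono (integrable_slanted_kernel hm hφc hφ hη s)
    ((integrable_norm_sq_add hm hA).const_mul ((2 + 2 * Λ ^ 2) ^ m))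
    (slanted_kernel_le hm0 hφ hη s)
  rw [integral_const_mul, integral_norm_sq_add hA] at h1
  calc slabKernel φ m η s ≤ _ := h1
    _ = _ := by ring

theorem bracketIntegral_nonneg (n : ℕ) (m : ℝ) : 0 ≤ bracketIntegral n m :=
  integral_nonneg fun _ => by positivity

/-- Both bases are at least `R/(2 + 2Λ²)` with `R = |u|² + s²`, and they differ by `(φ - ψ)(2s + φ +
ψ) = O(R^((1+b)/2) R^(1/2))`; this gains `R^(b/2)` over the kernel itself. It is used with `b = β`
(Hölder gradient) and with `b = 0` (Lipschitz bound only). -/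
theorem slanted_kernel_sub_le (hm : 0 ≤ m) (hΛ : 0 ≤ Λ) (hφ : ∀ u, |φ u| ≤ Λ * ‖u‖)
    (hψ : ∀ u, |ψ u| ≤ Λ * ‖u‖) {b l : ℝ} (hb : 0 ≤ b) (hl : 0 ≤ l)
    (hφψ : ∀ u, |φ u - ψ u| ≤ l * ‖u‖ ^ (1 + b)) (η : ℝ) {s : ℝ} (hs : s ≠ 0)
    (u : EuclideanSpace ℝ (Fin n)) :
    |(‖u‖ ^ 2 + (s + φ u) ^ 2 + η ^ 2) ^ (-m) - (‖u‖ ^ 2 + (s + ψ u) ^ 2 + η ^ 2) ^ (-m)| ≤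
      m * (2 + 2 * Λ ^ 2) ^ (m + 1) * (l * (2 + 2 * Λ)) *
        (‖u‖ ^ 2 + s ^ 2) ^ (-(m - b / 2)) := by
  have hM : (0 : ℝ) < 2 + 2 * Λ ^ 2 := by positivity
  have hs2 : 0 < s ^ 2 := by positivity
  set R := ‖u‖ ^ 2 + s ^ 2 with hR
  have hR0 : 0 < R := by positivity
  have hle : ∀ f : ℝ, |f| ≤ Λ * ‖u‖ →
      (2 + 2 * Λ ^ 2)⁻¹ * R ≤ ‖u‖ ^ 2 + (s + f) ^ 2 + η ^ 2 := by
    intro f hf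
    rw [inv_mul_le_iff₀ hM]
    have := sq_add_sq_le_slanted (s := s) hf
    nlinarith [sq_nonneg η, sq_nonneg (Λ * η)]
  have h1 := abs_rpow_neg_sub_rpow_neg_le (m := m) (by positivity) (hle _ (hφ u)) (hle _ (hψ u)) hm
  refine h1.trans ?_
  have hu : ‖u‖ ≤ R ^ (1 / 2 : ℝ) := by
    rw [← Real.sqrt_eq_rpow]
    exact Real.le_sqrt_of_sq_le (by linarith)
  have hsR : |s| ≤ R ^ (1 / 2 : ℝ) := by
    rw [← Real.sqrt_eq_rpow]
    refine Real.le_sqrt_of_sq_le ?_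
    rw [sq_abs]
    nlinarith [sq_nonneg ‖u‖]
  have h2 : |‖u‖ ^ 2 + (s + φ u) ^ 2 + η ^ 2 - (‖u‖ ^ 2 + (s + ψ u) ^ 2 + η ^ 2)| ≤
      l * (2 + 2 * Λ) * (R ^ ((1 + b) / 2) * R ^ (1 / 2 : ℝ)) := by
    have : ‖u‖ ^ 2 + (s + φ u) ^ 2 + η ^ 2 - (‖u‖ ^ 2 + (s + ψ u) ^ 2 + η ^ 2) =
        (φ u - ψ u) * (2 * s + φ u + ψ u) := by ring
    rw [this, abs_mul]
    have h3 : |φ u - ψ u| ≤ l * R ^ ((1 + b) / 2) := by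
      refine (hφψ u).trans ?_
      have := Real.rpow_le_rpow (norm_nonneg u) hu (show 0 ≤ 1 + b by linarith)
      rw [← Real.rpow_mul hR0.le, show (1 / 2 : ℝ) * (1 + b) = (1 + b) / 2 by ring] at this
      gcongr
    have h4 : |2 * s + φ u + ψ u| ≤ (2 + 2 * Λ) * R ^ (1 / 2 : ℝ) := by
      have h5 := abs_add_three (2 * s) (φ u) (ψ u)
      rw [abs_mul, abs_two] at h5
      have h6 := hφ u
      have h7 := hψ u
      have h8 : Λ * ‖u‖ ≤ Λ * R ^ (1 / 2 : ℝ) := by gcongr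
      linarith
    calc |φ u - ψ u| * |2 * s + φ u + ψ u|
        ≤ (l * R ^ ((1 + b) / 2)) * ((2 + 2 * Λ) * R ^ (1 / 2 : ℝ)) := by gcongr
      _ = _ := by ring
  have h9 : ((2 + 2 * Λ ^ 2)⁻¹ * R) ^ (-m - 1) = (2 + 2 * Λ ^ 2) ^ (m + 1) * R ^ (-m - 1) := by
    rw [Real.mul_rpow (by positivity) hR0.le, Real.inv_rpow hM.le, ← Real.rpow_neg hM.le]
    ring_nf
  have h10 : R ^ (-(m - b / 2)) = R ^ (-m - 1) * (R ^ ((1 + b) / 2) * R ^ (1 / 2 : ℝ)) := by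
    rw [← Real.rpow_add hR0, ← Real.rpow_add hR0]
    ring_nf
  rw [h9, h10]
  calc m * ((2 + 2 * Λ ^ 2) ^ (m + 1) * R ^ (-m - 1)) *
        |‖u‖ ^ 2 + (s + φ u) ^ 2 + η ^ 2 - (‖u‖ ^ 2 + (s + ψ u) ^ 2 + η ^ 2)|
      ≤ m * ((2 + 2 * Λ ^ 2) ^ (m + 1) * R ^ (-m - 1)) *
        (l * (2 + 2 * Λ) * (R ^ ((1 + b) / 2) * R ^ (1 / 2 : ℝ))) := by gcongr
    _ = _ := by ring

theorem abs_slabKernel_sub_le (hm : (n : ℝ) / 2 < m) (hΛ : 0 ≤ Λ) (hφc : Continuous φ)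
    (hψc : Continuous ψ) (hφ : ∀ u, |φ u| ≤ Λ * ‖u‖)
    (hψ : ∀ u, |ψ u| ≤ Λ * ‖u‖) {b l : ℝ} (hb : 0 ≤ b) (hbm : (n : ℝ) / 2 < m - b / 2)
    (hl : 0 ≤ l) (hφψ : ∀ u, |φ u - ψ u| ≤ l * ‖u‖ ^ (1 + b)) {η : ℝ} (hη : 0 < η) {s : ℝ}
    (hs : s ≠ 0) :
    |slabKernel φ m η s - slabKernel ψ m η s| ≤
      m * (2 + 2 * Λ ^ 2) ^ (m + 1) * (l * (2 + 2 * Λ)) * bracketIntegral n (m - b / 2) *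
        |s| ^ ((n : ℝ) - 2 * m + b) := by
  have hm0 : 0 ≤ m := by have : (0 : ℝ) ≤ n := n.cast_nonneg; linarith
  have hs2 : 0 < s ^ 2 := by positivity
  unfold slabKernel
  rw [← integral_sub (integrable_slanted_kernel hm hφc hφ hη s)
    (integrable_slanted_kernel hm hψc hψ hη s), ← Real.norm_eq_abs]
  refine (norm_integral_le_of_norm_le ((integrable_norm_sq_add hbm hs2).const_mul
    (m * (2 + 2 * Λ ^ 2) ^ (m + 1) * (l * (2 + 2 * Λ)))) (Eventually.of_forall fun u =>
      slanted_kernel_sub_le hm0 hΛ hφ hψ hb hl hφψ η hs u)).trans (le_of_eq ?_)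
  rw [integral_const_mul, integral_norm_sq_add hs2, ← sq_abs s, ← Real.rpow_natCast |s|,
    ← Real.rpow_mul (abs_nonneg s),
    show ((2 : ℕ) : ℝ) * ((n : ℝ) / 2 - (m - b / 2)) = (n : ℝ) - 2 * m + b by push_cast; ring]
  ring

end Kernel

/-! ### Integrating the kernel error against `|t^p - h^p|` -/

/-- By homogeneity take `h = 1`. Since `0 < p ≤ 2`, `τ^p` lies between `1` and `τ²`, and `|τ² - 1| =
(τ + 1)|τ - 1| ≤ 3|τ - 1|` for `τ ≤ 2`. -/
theorem abs_rpow_sub_rpow_le {p h t : ℝ} (hp : 0 < p) (hp2 : p ≤ 2) (hh : 0 < h) (ht : 0 < t)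
    (hth : t ≤ 2 * h) : |t ^ p - h ^ p| ≤ 3 * h ^ (p - 1) * |t - h| := by
  have hτ : 0 < t / h := by positivity
  have hτ2 : t / h ≤ 2 := by rw [div_le_iff₀ hh]; linarith
  have key : |(t / h) ^ p - 1| ≤ 3 * |t / h - 1| := by
    set τ := t / h
    rcases le_total τ 1 with h1 | h1
    · have h2 : τ ^ p ≤ 1 := Real.rpow_le_one hτ.le h1 hp.le
      have h3 := Real.rpow_le_rpow_of_exponent_ge hτ h1 hp2
      rw [Real.rpow_two] at h3
      rw [abs_of_nonpos (by linarith), abs_of_nonpos (by linarith)]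
      nlinarith
    · have h2 : 1 ≤ τ ^ p := Real.one_le_rpow h1 hp.le
      have h3 := Real.rpow_le_rpow_of_exponent_le h1 hp2
      rw [Real.rpow_two] at h3
      rw [abs_of_nonneg (by linarith), abs_of_nonneg (by linarith)]
      nlinarith
  have h4 : t ^ p - h ^ p = h ^ p * ((t / h) ^ p - 1) := by
    rw [Real.div_rpow ht.le hh.le]
    have := (Real.rpow_pos_of_pos hh p).ne'
    field_simp
  have h5 : t - h = h * (t / h - 1) := by field_simp
  rw [h4, h5, abs_mul, abs_mul, abs_of_pos hh, abs_of_pos (Real.rpow_pos_of_pos hh p),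
    Real.rpow_sub_one hh.ne']
  have := mul_le_mul_of_nonneg_left key (Real.rpow_pos_of_pos hh p).le
  calc h ^ p * |(t / h) ^ p - 1| ≤ h ^ p * (3 * |t / h - 1|) := this
    _ = 3 * (h ^ p / h) * (h * |t / h - 1|) := by field_simp

theorem integrableOn_rpow_sub_left {e h : ℝ} (he : -1 < e) (hh : 0 < h) :
    IntegrableOn (fun t : ℝ => (h - t) ^ e) (Ioc 0 h) ∧
      ∫ t in Ioc 0 h, (h - t) ^ e = h ^ (e + 1) / (e + 1) := by
  have h5 : IntervalIntegrable (fun σ : ℝ => σ ^ e) volume 0 h :=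
    intervalIntegral.intervalIntegrable_rpow' he
  constructor
  · have h6 := (h5.comp_sub_left h).symm
    simp only [sub_zero, sub_self] at h6
    exact (intervalIntegrable_iff_integrableOn_Ioc_of_le hh.le).1 h6
  · rw [← intervalIntegral.integral_of_le hh.le,
      intervalIntegral.integral_comp_sub_left (fun t => t ^ e) h, sub_self, sub_zero,
      integral_rpow (Or.inl he), Real.zero_rpow (by linarith), sub_zero]

theorem integrableOn_rpow_sub_right {e h : ℝ} (he : -1 < e) (hh : 0 < h) :
    IntegrableOn (fun t : ℝ => (t - h) ^ e) (Ioc h (2 * h)) ∧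
      ∫ t in Ioc h (2 * h), (t - h) ^ e = h ^ (e + 1) / (e + 1) := by
  have h5 : IntervalIntegrable (fun σ : ℝ => σ ^ e) volume 0 h :=
    intervalIntegral.intervalIntegrable_rpow' he
  have hle : h ≤ 2 * h := by linarith
  constructor
  · have h6 := h5.comp_sub_right h
    rw [zero_add, show h + h = 2 * h by ring] at h6
    exact (intervalIntegrable_iff_integrableOn_Ioc_of_le hle).1 h6
  · rw [← intervalIntegral.integral_of_le hle,
      intervalIntegral.integral_comp_sub_right (fun t => t ^ e) h, sub_self,
      show 2 * h - h = h by ring,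
      integral_rpow (Or.inl he), Real.zero_rpow (by linarith), sub_zero]

/-- The source of the three error terms: the integral is logarithmic at `q = 0`, while otherwise it
is `(T^q - h^q)/q`, governed by the constant or by `h^q` according to the sign of `q`. -/
theorem exists_integral_rpow_sub_one_le (q : ℝ) {T : ℝ} (hT : 0 < T) :
    ∃ C, 0 ≤ C ∧ ∀ h, 0 < h → h ≤ T →
      ∫ t in Ioc h T, t ^ (q - 1) ≤ C * (1 + h ^ q + |Real.log h|) := by
  rcases eq_or_ne q 0 with rfl | hq
  · refine ⟨1 + |Real.log T|, by positivity, fun h hh hhT => ?_⟩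
    rw [← intervalIntegral.integral_of_le hhT]
    have : ∫ t in h..T, t ^ ((0 : ℝ) - 1) = ∫ t in h..T, t⁻¹ := by
      congr 1; ext t; rw [zero_sub, Real.rpow_neg_one]
    rw [this, integral_inv_of_pos hh hT, Real.log_div hT.ne' hh.ne', Real.rpow_zero]
    have h1 := le_abs_self (Real.log T)
    have h2 := neg_abs_le (Real.log h)
    have h3 : 0 ≤ |Real.log T| * |Real.log h| := by positivity
    nlinarith [abs_nonneg (Real.log T), abs_nonneg (Real.log h)]
  · refine ⟨(1 + T ^ q) / |q|, by positivity, fun h hh hhT => ?_⟩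
    rw [← intervalIntegral.integral_of_le hhT, integral_rpow, sub_add_cancel]
    · have hTq := Real.rpow_pos_of_pos hT q
      have hhq := Real.rpow_pos_of_pos hh q
      have hq' : 0 < |q| := abs_pos.2 hq
      refine (le_abs_self _).trans ?_
      rw [abs_div, div_mul_eq_mul_div]
      gcongr
      have h1 := abs_sub (T ^ q) (h ^ q)
      rw [abs_of_pos hTq, abs_of_pos hhq] at h1
      have h2 := abs_nonneg (Real.log h)
      nlinarith [mul_pos hTq hhq, mul_nonneg hTq.le h2]
    · refine Or.inr ⟨fun h => hq (by linarith), ?_⟩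
      rw [uIcc_of_le hhT]
      exact fun h => absurd h.1 (not_le.2 hh)

theorem half_rpow_le {t e : ℝ} (ht : 0 < t) (he : e ≤ 0) (he3 : -3 ≤ e) {s : ℝ} (hs : t / 2 ≤ s) :
    s ^ e ≤ 8 * t ^ e := by
  have h1 : s ^ e ≤ (t / 2) ^ e := Real.rpow_le_rpow_of_nonpos (by positivity) hs he
  refine h1.trans ?_
  rw [Real.div_rpow ht.le (by norm_num), div_eq_mul_inv, ← Real.rpow_neg (by norm_num), mul_comm]
  have h2 : (2 : ℝ) ^ (-e) ≤ 2 ^ (3 : ℝ) :=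
    Real.rpow_le_rpow_of_exponent_le (by norm_num) (by linarith)
  have h3 : (2 : ℝ) ^ (3 : ℝ) = 8 := by norm_num
  rw [h3] at h2
  gcongr

/-- Up to `2h`, `|t^p - h^p| = O(h^(p-1)|t - h|)` and the Hölder bound leaves `|t - h|^(β-α)`,
integrable because `β > α - 1`, with total `O(h^(p-α+β))`. From there to `H` the integrand is
`O(t^(p-α+β-1))`. Beyond `H` that power need not be integrable, so the Lipschitz bound is used,
giving `t^(p-α-1)`. -/
theorem exists_profile_majorant {α β p H : ℝ} (hα2 : α < 2) (hβα : α - 1 < β)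
    (hβ1 : β ≤ 1) (hp : 0 < p) (hpα : p < α) (hH : 0 < H) :
    ∃ C, 0 ≤ C ∧ ∀ h, 0 < h → h ≤ H → ∃ g : ℝ → ℝ, IntegrableOn g (Ioi 0) ∧
      ∫ t in Ioi 0, g t ≤ C * (1 + h ^ (p - α + β) + |Real.log h|) ∧
      ∀ t, 0 < t → t ≠ h →
        |t ^ p - h ^ p| * min (|t - h| ^ (-1 - α + β)) (|t - h| ^ (-1 - α)) ≤ g t := by
  have he : -1 < β - α := by linarith
  obtain ⟨C₁, hC₁0, hC₁⟩ := exists_integral_rpow_sub_one_le (p - α + β) hH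
  set C₂ := ∫ t in Ioi H, t ^ (p - α - 1) with hC₂
  have hC₂0 : 0 ≤ C₂ := setIntegral_nonneg measurableSet_Ioi fun t ht =>
    Real.rpow_nonneg (hH.le.trans (le_of_lt ht)) _
  refine ⟨6 / (β - α + 1) + 8 * C₁ + 8 * C₂, by
    have : 0 < β - α + 1 := by linarith
    positivity, fun h hh hhH => ?_⟩
  obtain ⟨iA, vA⟩ := integrableOn_rpow_sub_left he hh
  obtain ⟨iB, vB⟩ := integrableOn_rpow_sub_right he hh
  have iC : IntegrableOn (fun t : ℝ => t ^ (p - α + β - 1)) (Ioc h H) := by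
    rw [← intervalIntegrable_iff_integrableOn_Ioc_of_le hhH]
    refine intervalIntegral.intervalIntegrable_rpow (Or.inr ?_)
    rw [uIcc_of_le hhH]
    exact fun h => absurd h.1 (not_le.2 hh)
  have iD : IntegrableOn (fun t : ℝ => t ^ (p - α - 1)) (Ioi H) :=
    integrableOn_Ioi_rpow_of_lt (by linarith) hH
  set gA := (Ioc 0 h).indicator fun t : ℝ => 3 * h ^ (p - 1) * (h - t) ^ (β - α) with hgA
  set gB := (Ioc h (2 * h)).indicator fun t : ℝ => 3 * h ^ (p - 1) * (t - h) ^ (β - α) with hgB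
  set gC := (Ioc h H).indicator fun t : ℝ => 8 * t ^ (p - α + β - 1) with hgC
  set gD := (Ioi H).indicator fun t : ℝ => 8 * t ^ (p - α - 1) with hgD
  have jA : Integrable gA := IntegrableOn.integrable_indicator (iA.const_mul _) measurableSet_Ioc
  have jB : Integrable gB := IntegrableOn.integrable_indicator (iB.const_mul _) measurableSet_Ioc
  have jC : Integrable gC := IntegrableOn.integrable_indicator (iC.const_mul _) measurableSet_Ioc
  have jD : Integrable gD := IntegrableOn.integrable_indicator (iD.const_mul _) measurableSet_Ioi
  have nA : ∀ t, 0 ≤ gA t := fun t => indicator_nonneg (fun t ht => by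
    have := Real.rpow_nonneg (sub_nonneg.2 ht.2) (β - α); positivity) t
  have nB : ∀ t, 0 ≤ gB t := fun t => indicator_nonneg (fun t ht => by
    have := Real.rpow_nonneg (sub_nonneg.2 ht.1.le) (β - α); positivity) t
  have nC : ∀ t, 0 ≤ gC t := fun t => indicator_nonneg (fun t ht => by
    have := Real.rpow_nonneg (hh.trans ht.1).le (p - α + β - 1); positivity) t
  have nD : ∀ t, 0 ≤ gD t := fun t => indicator_nonneg (fun t ht => by
    have := Real.rpow_nonneg (hH.trans ht).le (p - α - 1); positivity) t
  refine ⟨fun t => gA t + gB t + gC t + gD t, (((jA.add jB).add jC).add jD).integrableOn, ?_, ?_⟩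
  · have h1 : ∫ t in Ioi 0, (gA t + gB t + gC t + gD t) ≤ ∫ t, (gA t + gB t + gC t + gD t) :=
      setIntegral_le_integral (((jA.add jB).add jC).add jD) (Eventually.of_forall fun t => by
        have := nA t; have := nB t; have := nC t; have := nD t
        simp only [Pi.zero_apply]; positivity)
    refine h1.trans ?_
    have sAB : Integrable (fun t => gA t + gB t) := jA.add jB
    have sABC : Integrable (fun t => gA t + gB t + gC t) := sAB.add jC
    rw [integral_add sABC jD, integral_add sAB jC, integral_add jA jB, hgA, hgB, hgC, hgD,
      integral_indicator measurableSet_Ioc, integral_indicator measurableSet_Ioc,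
      integral_indicator measurableSet_Ioc, integral_indicator measurableSet_Ioi,
      integral_const_mul, integral_const_mul, integral_const_mul, integral_const_mul, vA, vB, ← hC₂]
    have h2 := hC₁ h hh hhH
    have h3 : h ^ (p - 1) * h ^ (β - α + 1) = h ^ (p - α + β) := by
      rw [← Real.rpow_add hh]; ring_nf
    have h4 : 0 < β - α + 1 := by linarith
    have h5 : 3 * h ^ (p - 1) * (h ^ (β - α + 1) / (β - α + 1)) +
        3 * h ^ (p - 1) * (h ^ (β - α + 1) / (β - α + 1)) =
        6 / (β - α + 1) * h ^ (p - α + β) := by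
      rw [← h3]; field_simp; ring
    rw [h5]
    have h6 : 0 < h ^ (p - α + β) := Real.rpow_pos_of_pos hh _
    have h7 := abs_nonneg (Real.log h)
    have h8 : 0 < 6 / (β - α + 1) := by positivity
    set Q := 1 + h ^ (p - α + β) + |Real.log h| with hQ
    have h9 : 6 / (β - α + 1) * h ^ (p - α + β) ≤ 6 / (β - α + 1) * Q := by
      gcongr; linarith
    have h10 : C₂ ≤ C₂ * Q := le_mul_of_one_le_right hC₂0 (by linarith)
    linarith
  · intro t ht hth
    have hmin0 : 0 ≤ min (|t - h| ^ (-1 - α + β)) (|t - h| ^ (-1 - α)) := by positivity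
    have hpos : 0 < |t - h| := abs_pos.2 (sub_ne_zero.2 hth)
    have hnear : t ≤ 2 * h →
        |t ^ p - h ^ p| * min (|t - h| ^ (-1 - α + β)) (|t - h| ^ (-1 - α)) ≤
          3 * h ^ (p - 1) * |t - h| ^ (β - α) := by
      intro hle
      have h1 := abs_rpow_sub_rpow_le hp (by linarith) hh ht hle
      have h2 : |t - h| ^ (β - α) = |t - h| * |t - h| ^ (-1 - α + β) := by
        rw [mul_comm, ← Real.rpow_add_one hpos.ne']; ring_nf
      calc |t ^ p - h ^ p| * min (|t - h| ^ (-1 - α + β)) (|t - h| ^ (-1 - α))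
          ≤ (3 * h ^ (p - 1) * |t - h|) * |t - h| ^ (-1 - α + β) := by
            gcongr; exact min_le_left _ _
        _ = _ := by rw [h2]; ring
    have hfar : 2 * h < t → ∀ e, e ≤ 0 → -3 ≤ e →
        min (|t - h| ^ (-1 - α + β)) (|t - h| ^ (-1 - α)) ≤ |t - h| ^ e →
        |t ^ p - h ^ p| * min (|t - h| ^ (-1 - α + β)) (|t - h| ^ (-1 - α)) ≤ 8 * t ^ (p + e) := by
      intro hlt e he0 he3 hmin
      have h1 : t / 2 ≤ |t - h| := by rw [abs_of_nonneg (by linarith)]; linarith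
      have h2 := half_rpow_le ht he0 he3 h1
      have h3 : h ^ p ≤ t ^ p := Real.rpow_le_rpow hh.le (by linarith) hp.le
      have h4 : |t ^ p - h ^ p| ≤ t ^ p := by
        rw [abs_of_nonneg (by linarith)]
        linarith [Real.rpow_pos_of_pos hh p]
      calc |t ^ p - h ^ p| * min (|t - h| ^ (-1 - α + β)) (|t - h| ^ (-1 - α))
          ≤ t ^ p * (8 * t ^ e) := mul_le_mul h4 (hmin.trans h2) hmin0 (by positivity)
        _ = _ := by rw [Real.rpow_add ht]; ring
    have hA := nA t
    have hB := nB t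
    have hC := nC t
    have hD := nD t
    rcases le_or_gt t h with h1 | h1
    · have h2 : gA t = 3 * h ^ (p - 1) * |t - h| ^ (β - α) := by
        rw [hgA, indicator_of_mem (show t ∈ Ioc 0 h from ⟨ht, h1⟩), abs_sub_comm,
          abs_of_nonneg (by linarith)]
      linarith [hnear (by linarith)]
    rcases le_or_gt t (2 * h) with h3 | h3
    · have h2 : gB t = 3 * h ^ (p - 1) * |t - h| ^ (β - α) := by
        rw [hgB, indicator_of_mem (show t ∈ Ioc h (2 * h) from ⟨h1, h3⟩),
          abs_of_nonneg (by linarith)]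
      linarith [hnear h3]
    rcases le_or_gt t H with h4 | h4
    · have h2 : gC t = 8 * t ^ (p + (-1 - α + β)) := by
        rw [hgC, indicator_of_mem (show t ∈ Ioc h H from ⟨h1, h4⟩)]
        ring_nf
      linarith [hfar h3 (-1 - α + β) (by linarith) (by linarith) (min_le_left _ _)]
    · have h2 : gD t = 8 * t ^ (p + (-1 - α)) := by
        rw [hgD, indicator_of_mem (show t ∈ Ioi H from h4)]
        ring_nf
      linarith [hfar h3 (-1 - α) (by linarith) (by linarith) (min_le_right _ _)]

/-! ### Tangential and vertical coordinates -/

section Coordinates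

variable {n : ℕ}

theorem tangential_sub (y x : EuclideanSpace ℝ (Fin (n + 1))) :
    tangential (y - x) = tangential y - tangential x := by
  ext i; simp [tangential]

theorem height_sub (y x : EuclideanSpace ℝ (Fin (n + 1))) :
    height (y - x) = height y - height x := by
  simp [height]

theorem norm_sq_eq_tangential_add_height (y : EuclideanSpace ℝ (Fin (n + 1))) :
    ‖y‖ ^ 2 = ‖tangential y‖ ^ 2 + height y ^ 2 := by
  rw [EuclideanSpace.norm_sq_eq, EuclideanSpace.norm_sq_eq, Fin.sum_univ_castSucc]
  simp [tangential, height]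

theorem norm_tangential_le (y : EuclideanSpace ℝ (Fin (n + 1))) : ‖tangential y‖ ≤ ‖y‖ := by
  refine le_of_sq_le_sq ?_ (norm_nonneg y)
  rw [norm_sq_eq_tangential_add_height y]
  nlinarith [sq_nonneg (height y)]

theorem abs_height_le (y : EuclideanSpace ℝ (Fin (n + 1))) : |height y| ≤ ‖y‖ := by
  refine abs_le_of_sq_le_sq ?_ (norm_nonneg y)
  rw [norm_sq_eq_tangential_add_height y]
  nlinarith [sq_nonneg ‖tangential y‖]

/-- The measurable equivalence between `ℝ^(n+1)` and `ℝ^n × ℝ`. -/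
noncomputable def splitEquiv (n : ℕ) :
    EuclideanSpace ℝ (Fin (n + 1)) ≃ᵐ EuclideanSpace ℝ (Fin n) × ℝ :=
  (MeasurableEquiv.toLp 2 (Fin (n + 1) → ℝ)).symm.trans
    ((MeasurableEquiv.piFinSuccAbove (fun _ => ℝ) (Fin.last n)).trans
      (MeasurableEquiv.prodComm.trans
        ((MeasurableEquiv.toLp 2 (Fin n → ℝ)).prodCongr (MeasurableEquiv.refl ℝ))))

theorem splitEquiv_apply (y : EuclideanSpace ℝ (Fin (n + 1))) :
    splitEquiv n y = (tangential y, height y) := by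
  refine Prod.ext ?_ rfl
  ext i
  change y ((Fin.last n).succAbove i) = y i.castSucc
  rw [Fin.succAbove_last]

theorem measurePreserving_splitEquiv :
    MeasurePreserving (splitEquiv n) volume (volume.prod volume) := by
  have h1 := PiLp.volume_preserving_ofLp (Fin (n + 1))
  have h2 := volume_preserving_piFinSuccAbove (fun _ : Fin (n + 1) => ℝ) (Fin.last n)
  have h3 : MeasurePreserving (Prod.swap : ℝ × (Fin n → ℝ) → (Fin n → ℝ) × ℝ)
    (volume.prod volume) (volume.prod volume) := Measure.measurePreserving_swap
  have h4 := (PiLp.volume_preserving_toLp (Fin n)).prod (MeasurePreserving.id (volume : Measure ℝ))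
  exact h4.comp (h3.comp (h2.comp h1))

theorem continuous_tangential : Continuous (tangential : EuclideanSpace ℝ (Fin (n + 1)) → _) := by
  unfold tangential
  fun_prop

theorem continuous_height : Continuous (height : EuclideanSpace ℝ (Fin (n + 1)) → ℝ) := by
  unfold height
  fun_prop

end Coordinates

/-! ### Flattening the graph by a volume-preserving shear -/

section Flattening

variable {n : ℕ} {G : EuclideanSpace ℝ (Fin n) → ℝ}

theorem measurableSet_aboveGraph (hG : Continuous G) : MeasurableSet (aboveGraph G) :=
  (isOpen_lt (hG.comp continuous_tangential) continuous_height).measurableSet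

theorem continuous_vertDist (hG : Continuous G) : Continuous (vertDist G) := by
  unfold vertDist
  exact (continuous_height.sub (hG.comp continuous_tangential)).abs

/-- The map is a translation in `u` followed, for each fixed `u`, by a translation in `t`, so no
Jacobian appears even though `G` is merely continuous. -/
theorem measurePreserving_shear (hG : Continuous G) (a : EuclideanSpace ℝ (Fin n)) :
    MeasurePreserving (fun q : EuclideanSpace ℝ (Fin n) × ℝ => (a + q.1, G (a + q.1) + q.2))
      (volume.prod volume) (volume.prod volume) :=
  (measurePreserving_add_left volume a).skew_product (g := fun u t => G (a + u) + t)
    (by simp only [Function.uncurry_def]; fun_prop)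
    (Eventually.of_forall fun u => (measurePreserving_add_left volume (G (a + u))).map_eq)

/-- The shear `(u, t) ↦ (a + u, G (a + u) + t)`. -/
noncomputable def shearEquiv (hG : Continuous G) (a : EuclideanSpace ℝ (Fin n)) :
    (EuclideanSpace ℝ (Fin n) × ℝ) ≃ᵐ (EuclideanSpace ℝ (Fin n) × ℝ) where
  toFun q := (a + q.1, G (a + q.1) + q.2)
  invFun q := (q.1 - a, q.2 - G q.1)
  left_inv q := by simp
  right_inv q := by simp
  measurable_toFun := (measurePreserving_shear hG a).measurable
  measurable_invFun := by
    have := hG.measurable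
    change Measurable fun q : EuclideanSpace ℝ (Fin n) × ℝ => (q.1 - a, q.2 - G q.1)
    fun_prop

/-- Coordinates `(u, t)` of `ℝ^(n+1)` centred at `a` that flatten the graph of `G`. -/
noncomputable def flatEquiv (hG : Continuous G) (a : EuclideanSpace ℝ (Fin n)) :
    (EuclideanSpace ℝ (Fin n) × ℝ) ≃ᵐ EuclideanSpace ℝ (Fin (n + 1)) :=
  (shearEquiv hG a).trans (splitEquiv n).symm

theorem flatEquiv_coords (hG : Continuous G) (a : EuclideanSpace ℝ (Fin n))
    (q : EuclideanSpace ℝ (Fin n) × ℝ) :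
    tangential (flatEquiv hG a q) = a + q.1 ∧ height (flatEquiv hG a q) = G (a + q.1) + q.2 := by
  have h : splitEquiv n (flatEquiv hG a q) = (a + q.1, G (a + q.1) + q.2) := by
    simp only [flatEquiv, MeasurableEquiv.trans_apply, MeasurableEquiv.apply_symm_apply]
    rfl
  rw [splitEquiv_apply] at h
  exact ⟨congrArg Prod.fst h, congrArg Prod.snd h⟩

theorem measurePreserving_flatEquiv (hG : Continuous G) (a : EuclideanSpace ℝ (Fin n)) :
    MeasurePreserving (flatEquiv hG a) (volume.prod volume) volume :=
  (MeasurePreserving.symm (splitEquiv n) measurePreserving_splitEquiv).comp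
    (measurePreserving_shear hG a)

theorem flatEquiv_preimage_aboveGraph (hG : Continuous G) (a : EuclideanSpace ℝ (Fin n)) :
    flatEquiv hG a ⁻¹' aboveGraph G = univ ×ˢ Ioi 0 := by
  ext q
  obtain ⟨h1, h2⟩ := flatEquiv_coords hG a q
  simp [aboveGraph, h1, h2]

theorem setIntegral_aboveGraph (hG : Continuous G) (a : EuclideanSpace ℝ (Fin n))
    {f : EuclideanSpace ℝ (Fin (n + 1)) → ℝ} (hf : IntegrableOn f (aboveGraph G)) :
    ∫ y in aboveGraph G, f y = ∫ t in Ioi (0 : ℝ), ∫ u, f (flatEquiv hG a (u, t)) := by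
  have hmp := measurePreserving_flatEquiv hG a
  have hemb := (flatEquiv hG a).measurableEmbedding
  have h1 := hmp.setIntegral_preimage_emb hemb f (aboveGraph G)
  have h2 := (hmp.integrableOn_comp_preimage hemb (f := f) (s := aboveGraph G)).2 hf
  rw [flatEquiv_preimage_aboveGraph] at h1 h2
  rw [IntegrableOn, ← Measure.prod_restrict, Measure.restrict_univ] at h2
  rw [← h1, ← Measure.prod_restrict, Measure.restrict_univ]
  exact integral_prod_symm _ h2

/-- In flat coordinates centred at `x̃` the vertical distance is `t` and `|y - x|² = |u|² + (t - h +
φ(u))²`; hence the factor in `t` leaves the inner integral. -/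
theorem setIntegral_regularised (hG : Continuous G) (x : EuclideanSpace ℝ (Fin (n + 1)))
    (hx : x ∈ aboveGraph G) {p m η : ℝ}
    (hint : IntegrableOn (fun y => (vertDist G y ^ p - vertDist G x ^ p) *
      (‖y - x‖ ^ 2 + η ^ 2) ^ (-m)) (aboveGraph G)) :
    ∫ y in aboveGraph G, (vertDist G y ^ p - vertDist G x ^ p) * (‖y - x‖ ^ 2 + η ^ 2) ^ (-m) =
      ∫ t in Ioi (0 : ℝ), (t ^ p - vertDist G x ^ p) *
        slabKernel (fun u => G (tangential x + u) - G (tangential x)) m η (t - vertDist G x) := by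
  rw [setIntegral_aboveGraph hG (tangential x) hint]
  refine setIntegral_congr_fun measurableSet_Ioi fun t ht => ?_
  have ht : 0 < t := ht
  simp only [slabKernel]
  rw [← integral_const_mul]
  refine integral_congr_ae (Eventually.of_forall fun u => ?_)
  obtain ⟨h1, h2⟩ := flatEquiv_coords hG (tangential x) (u, t)
  have h3 : vertDist G (flatEquiv hG (tangential x) (u, t)) = t := by
    simp only [vertDist, h1, h2]
    rw [add_sub_cancel_left, abs_of_pos ht]
  have hx' : G (tangential x) < height x := hx
  have h4 : vertDist G x = height x - G (tangential x) := abs_of_pos (by linarith)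
  simp only
  rw [h3, norm_sq_eq_tangential_add_height, tangential_sub, height_sub, h1, h2, h4]
  simp only [add_sub_cancel_left]
  ring_nf

end Flattening

/-! ### First-order estimates for the graph -/

section Graph

variable {n : ℕ} {β Λ : ℝ} {G : EuclideanSpace ℝ (Fin n) → ℝ}

theorem IsC1Holder.abs_sub_le (hG : IsC1Holder β Λ G) (v u : EuclideanSpace ℝ (Fin n)) :
    |G v - G u| ≤ Λ * ‖v - u‖ := by
  rw [← Real.norm_eq_abs]
  refine Convex.norm_image_sub_le_of_norm_fderiv_le (𝕜 := ℝ) (s := univ)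
    (fun w _ => hG.differentiable w) (fun w _ => ?_) convex_univ (mem_univ _) (mem_univ _)
  have := hG.gradient_le w
  rwa [gradient, LinearIsometryEquiv.norm_map] at this

/-- Mean value inequality for `G` minus its differential at `a`, on the ball of radius `‖u‖`, where
the gradient has moved by at most `Λ‖u‖^β`. -/
theorem IsC1Holder.abs_sub_sub_inner_le (hG : IsC1Holder β Λ G) (hΛ : 0 ≤ Λ) (hβ : 0 < β)
    (a u : EuclideanSpace ℝ (Fin n)) :
    |G (a + u) - G a - inner ℝ (gradient G a) u| ≤ Λ * ‖u‖ ^ (1 + β) := by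
  rcases eq_or_ne u 0 with rfl | hu
  · simp [Real.zero_rpow (show 1 + β ≠ 0 by linarith)]
  have h := Convex.norm_image_sub_le_of_norm_fderiv_le' (𝕜 := ℝ) (f := G) (φ := fderiv ℝ G a)
    (s := Metric.closedBall a ‖u‖) (C := Λ * ‖u‖ ^ β) (x := a) (y := a + u)
    (fun w _ => hG.differentiable w) (fun w hw => ?_) (convex_closedBall a ‖u‖)
    (Metric.mem_closedBall_self (norm_nonneg u)) (by simp)
  · rw [add_sub_cancel_left, Real.norm_eq_abs] at h
    rw [inner_gradient_left, Real.rpow_add (norm_pos_iff.2 hu), Real.rpow_one]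
    linarith
  · have h1 := hG.gradient_holder w a
    rw [gradient, gradient, ← map_sub, LinearIsometryEquiv.norm_map] at h1
    refine h1.trans ?_
    rw [mem_closedBall_iff_norm] at hw
    gcongr

theorem vertDist_eq {x : EuclideanSpace ℝ (Fin (n + 1))} (hx : x ∈ aboveGraph G) :
    vertDist G x = height x - G (tangential x) ∧ 0 < vertDist G x := by
  have hx' : G (tangential x) < height x := hx
  have h4 : vertDist G x = height x - G (tangential x) := abs_of_pos (by linarith)
  exact ⟨h4, by linarith⟩

theorem IsC1Holder.abs_height_sub_le (hG : IsC1Holder β Λ G) (hΛ : 0 ≤ Λ)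
    (x y : EuclideanSpace ℝ (Fin (n + 1))) :
    |(height y - G (tangential y)) - (height x - G (tangential x))| ≤ (1 + Λ) * ‖y - x‖ := by
  have h1 := hG.abs_sub_le (tangential y) (tangential x)
  rw [← tangential_sub] at h1
  have h2 := abs_height_le (y - x)
  rw [height_sub] at h2
  have h3 := mul_le_mul_of_nonneg_left (norm_tangential_le (y - x)) hΛ
  have h4 := abs_sub (height y - height x) (G (tangential y) - G (tangential x))
  have h5 : (height y - G (tangential y)) - (height x - G (tangential x)) =
    (height y - height x) - (G (tangential y) - G (tangential x)) := by ring
  rw [h5]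
  linarith

end Graph

/-! ### Principal values through even weights -/

section PrincipalValue

variable {d : ℕ} {D : Set (EuclideanSpace ℝ (Fin d))} {x : EuclideanSpace ℝ (Fin d)} {r e : ℝ}
  {F : EuclideanSpace ℝ (Fin d) → ℝ} {l : EuclideanSpace ℝ (Fin d) →L[ℝ] ℝ}
  {w : EuclideanSpace ℝ (Fin d) → ℝ}

/-- `F` with the linear part `l (y - x)` removed on the ball `B(x, r)`. -/
noncomputable def linearCorrected (F : EuclideanSpace ℝ (Fin d) → ℝ)
    (l : EuclideanSpace ℝ (Fin d) →L[ℝ] ℝ) (x : EuclideanSpace ℝ (Fin d)) (r : ℝ)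
    (y : EuclideanSpace ℝ (Fin d)) : ℝ :=
  F y - (Metric.ball x r).indicator (fun y => l (y - x)) y

theorem integral_eq_zero_of_odd {f : EuclideanSpace ℝ (Fin d) → ℝ} (hf : ∀ z, f (-z) = -f z) :
    ∫ z, f z = 0 := by
  have h1 := integral_neg_eq_self f volume
  simp_rw [hf] at h1
  rw [integral_neg] at h1
  linarith

theorem integrable_linear_mul_weight (hw : Measurable w) {M : ℝ} (hwM : ∀ z, |w z| ≤ M) :
    Integrable ((Metric.ball x r).indicator fun y => l (y - x) * w (y - x)) ∧
      ∫ y, (Metric.ball x r).indicator (fun y => l (y - x) * w (y - x)) y =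
        ∫ z, (Metric.ball 0 r).indicator (fun z => l z * w z) z := by
  have heq : ((Metric.ball x r).indicator fun y => l (y - x) * w (y - x)) =
      fun y => (Metric.ball 0 r).indicator (fun z => l z * w z) (y - x) := by
    ext y
    by_cases hy : y ∈ Metric.ball x r
    · rw [indicator_of_mem hy, indicator_of_mem]
      rwa [mem_ball_zero_iff, ← mem_ball_iff_norm]
    · rw [indicator_of_notMem hy, indicator_of_notMem]
      rwa [mem_ball_zero_iff, ← mem_ball_iff_norm]
  have hint : Integrable ((Metric.ball 0 r).indicator fun z => l z * w z) := by
    refine IntegrableOn.integrable_indicator ?_ measurableSet_ball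
    refine Measure.integrableOn_of_bounded (M := ‖l‖ * r * M) measure_ball_lt_top.ne ?_ ?_
    · exact (l.continuous.measurable.mul hw).aestronglyMeasurable
    · refine (ae_restrict_mem measurableSet_ball).mono fun z hz => ?_
      rw [mem_ball_zero_iff] at hz
      have hr : 0 ≤ r := (norm_nonneg z).trans hz.le
      have h1 : ‖l z‖ ≤ ‖l‖ * r := (l.le_opNorm z).trans (by gcongr)
      rw [norm_mul]
      have h2 := hwM z
      rw [← Real.norm_eq_abs] at h2
      gcongr
  rw [heq]
  exact ⟨hint.comp_sub_right x, integral_sub_right_eq_self _ x⟩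

/-- The correction `l(y - x) w(y - x)` is odd about `x` and supported in a ball inside `D`, so it
integrates to zero; boundedness of `w` makes it integrable. -/
theorem integral_mul_even_weight (hBD : Metric.ball x r ⊆ D)
    (hF : IntegrableOn (fun y => linearCorrected F l x r y * ‖y - x‖ ^ e) D)
    (hFm : Measurable F) (hw : Measurable w) {M : ℝ} (hwM : ∀ z, |w z| ≤ M)
    (hwe : ∀ z, w (-z) = w z) (hwle : ∀ z ≠ 0, |w z| ≤ ‖z‖ ^ e) (hd : 1 ≤ d) :
    IntegrableOn (fun y => F y * w (y - x)) D ∧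
      ∫ y in D, F y * w (y - x) = ∫ y in D, linearCorrected F l x r y * w (y - x) := by
  have : Nonempty (Fin d) := ⟨⟨0, hd⟩⟩
  obtain ⟨h1, h2⟩ := integrable_linear_mul_weight (x := x) (r := r) (l := l) hw hwM
  have hNm : Measurable (linearCorrected F l x r) := by
    refine hFm.sub (Measurable.indicator ?_ measurableSet_ball)
    exact (l.continuous.comp (continuous_id.sub continuous_const)).measurable
  have h3 : IntegrableOn (fun y => linearCorrected F l x r y * w (y - x)) D := by
    refine Integrable.mono hF ?_ ?_
    · exact (hNm.mul (hw.comp (measurable_id.sub_const x))).aestronglyMeasurable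
    · have h4 : ∀ᵐ y ∂(volume : Measure (EuclideanSpace ℝ (Fin d))), y ≠ x := by
        rw [ae_iff]; simp
      refine (ae_restrict_of_ae h4).mono fun y hy => ?_
      rw [norm_mul, norm_mul]
      have h5 := hwle (y - x) (sub_ne_zero.2 hy)
      rw [← Real.norm_eq_abs] at h5
      have h6 := h5.trans (le_abs_self _)
      rw [← Real.norm_eq_abs] at h6
      gcongr
  have heq : (fun y => F y * w (y - x)) = fun y => linearCorrected F l x r y * w (y - x) +
      (Metric.ball x r).indicator (fun y => l (y - x) * w (y - x)) y := by
    ext y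
    by_cases hy : y ∈ Metric.ball x r
    · simp only [linearCorrected, indicator_of_mem hy]; ring
    · simp only [linearCorrected, indicator_of_notMem hy]; ring
  have h7 : ∫ y in D, (Metric.ball x r).indicator (fun y => l (y - x) * w (y - x)) y = 0 := by
    rw [setIntegral_indicator measurableSet_ball, inter_eq_right.2 hBD,
      ← integral_indicator measurableSet_ball, h2]
    refine integral_eq_zero_of_odd fun z => ?_
    by_cases hz : z ∈ Metric.ball 0 r
    · have hz' : -z ∈ Metric.ball 0 r := by simpa using hz
      rw [indicator_of_mem hz, indicator_of_mem hz', hwe, map_neg, neg_mul]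
    · have hz' : -z ∉ Metric.ball 0 r := by simpa using hz
      rw [indicator_of_notMem hz, indicator_of_notMem hz', neg_zero]
  rw [heq]
  refine ⟨h3.add h1.integrableOn, ?_⟩
  rw [integral_add h3 h1.integrableOn, h7, add_zero]

/-- After the linear part is removed, dominated convergence applies to any even weights bounded by
`‖z‖^e` and tending to it. The limit does not depend on the family, which lets the sharp cut-off be
exchanged for the smooth regularisation. -/
theorem tendsto_integral_even_weight (hBD : Metric.ball x r ⊆ D)
    (hF : IntegrableOn (fun y => linearCorrected F l x r y * ‖y - x‖ ^ e) D)
    (hFm : Measurable F) {W : ℝ → EuclideanSpace ℝ (Fin d) → ℝ} (hw : ∀ η, Measurable (W η))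
    (hwM : ∀ η, 0 < η → ∃ M, ∀ z, |W η z| ≤ M)
    (hwe : ∀ η z, W η (-z) = W η z) (hwle : ∀ η, 0 < η → ∀ z ≠ 0, |W η z| ≤ ‖z‖ ^ e)
    (hlim : ∀ z ≠ 0, Tendsto (fun η => W η z) (𝓝[>] 0) (𝓝 (‖z‖ ^ e))) (hd : 1 ≤ d) :
    Tendsto (fun η => ∫ y in D, F y * W η (y - x)) (𝓝[>] 0)
      (𝓝 (∫ y in D, linearCorrected F l x r y * ‖y - x‖ ^ e)) := by
  have : Nonempty (Fin d) := ⟨⟨0, hd⟩⟩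
  have hNm : Measurable (linearCorrected F l x r) := by
    refine hFm.sub (Measurable.indicator ?_ measurableSet_ball)
    exact (l.continuous.comp (continuous_id.sub continuous_const)).measurable
  have h4 : ∀ᵐ y ∂((volume : Measure (EuclideanSpace ℝ (Fin d))).restrict D), y ≠ x :=
    ae_restrict_of_ae (by rw [ae_iff]; simp)
  have h1 : (fun η => ∫ y in D, F y * W η (y - x)) =ᶠ[𝓝[>] 0]
      fun η => ∫ y in D, linearCorrected F l x r y * W η (y - x) := by
    filter_upwards [self_mem_nhdsWithin] with η hη
    obtain ⟨M, hM⟩ := hwM η hη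
    exact (integral_mul_even_weight hBD hF hFm (hw η) hM (hwe η) (hwle η hη) hd).2
  refine Tendsto.congr' h1.symm ?_
  refine tendsto_integral_filter_of_dominated_convergence
    (fun y => ‖linearCorrected F l x r y * ‖y - x‖ ^ e‖) ?_ ?_ hF.norm ?_
  · exact Eventually.of_forall fun η =>
      (hNm.mul ((hw η).comp (measurable_id.sub_const x))).aestronglyMeasurable
  · filter_upwards [self_mem_nhdsWithin] with η hη
    refine h4.mono fun y hy => ?_
    rw [norm_mul, norm_mul]
    have h5 := hwle η hη (y - x) (sub_ne_zero.2 hy)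
    rw [← Real.norm_eq_abs] at h5
    have h6 := h5.trans (le_abs_self _)
    rw [← Real.norm_eq_abs] at h6
    gcongr
  · exact h4.mono fun y hy => (hlim (y - x) (sub_ne_zero.2 hy)).const_mul _

theorem hasPrincipalValue_of_linearCorrected
    (hBD : Metric.ball x r ⊆ D) (he : e ≤ 0)
    (hF : IntegrableOn (fun y => linearCorrected F l x r y * ‖y - x‖ ^ e) D)
    (hFm : Measurable F) (hd : 1 ≤ d) :
    HasPrincipalValue D (fun y => F y / ‖y - x‖ ^ (-e)) x
      (∫ y in D, linearCorrected F l x r y * ‖y - x‖ ^ e) := by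
  set W : ℝ → EuclideanSpace ℝ (Fin d) → ℝ :=
    fun η => (Metric.ball 0 η)ᶜ.indicator fun z => ‖z‖ ^ e with hW
  have hw : ∀ η, Measurable (W η) := fun η =>
    (by fun_prop : Measurable fun z : EuclideanSpace ℝ (Fin d) => ‖z‖ ^ e).indicator
      measurableSet_ball.compl
  have hwn : ∀ η z, 0 ≤ W η z := fun η z => indicator_nonneg (fun z _ => by positivity) z
  have hwM : ∀ η, 0 < η → ∀ z, |W η z| ≤ η ^ e := by
    intro η hη z
    rw [abs_of_nonneg (hwn η z)]
    refine indicator_le' (g := fun _ => η ^ e) (fun z hz => ?_) (fun z _ => by positivity) z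
    rw [mem_compl_iff, mem_ball_zero_iff, not_lt] at hz
    exact Real.rpow_le_rpow_of_nonpos hη hz he
  have hwe : ∀ η z, W η (-z) = W η z := by
    intro η z
    by_cases hz : z ∈ (Metric.ball (0 : EuclideanSpace ℝ (Fin d)) η)ᶜ
    · have hz' : -z ∈ (Metric.ball (0 : EuclideanSpace ℝ (Fin d)) η)ᶜ := by simpa using hz
      simp only [hW]
      rw [indicator_of_mem hz, indicator_of_mem hz', norm_neg]
    · have hz' : -z ∉ (Metric.ball (0 : EuclideanSpace ℝ (Fin d)) η)ᶜ := by simpa using hz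
      simp only [hW]
      rw [indicator_of_notMem hz, indicator_of_notMem hz']
  have hwle : ∀ η, 0 < η → ∀ z ≠ 0, |W η z| ≤ ‖z‖ ^ e := by
    intro η hη z hz
    rw [abs_of_nonneg (hwn η z)]
    exact indicator_le_self' (fun z _ => by positivity) z
  have heq : ∀ η, (fun y => F y * W η (y - x)) =
      (Metric.ball x η)ᶜ.indicator fun y => F y / ‖y - x‖ ^ (-e) := by
    intro η
    ext y
    by_cases hy : y ∈ (Metric.ball x η)ᶜ
    · have hy' : y - x ∈ (Metric.ball (0 : EuclideanSpace ℝ (Fin d)) η)ᶜ := by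
        rwa [mem_compl_iff, mem_ball_zero_iff, ← mem_ball_iff_norm]
      simp only [hW]
      rw [indicator_of_mem hy, indicator_of_mem hy', Real.rpow_neg (norm_nonneg _), div_inv_eq_mul]
    · have hy' : y - x ∉ (Metric.ball (0 : EuclideanSpace ℝ (Fin d)) η)ᶜ := by
        rwa [mem_compl_iff, mem_ball_zero_iff, ← mem_ball_iff_norm]
      simp only [hW]
      rw [indicator_of_notMem hy, indicator_of_notMem hy', mul_zero]
  constructor
  · intro η hη
    have h1 := (integral_mul_even_weight hBD hF hFm (hw η) (hwM η hη) (hwe η) (hwle η hη) hd).1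
    rw [heq, IntegrableOn, integrable_indicator_iff measurableSet_ball.compl, IntegrableOn,
      Measure.restrict_restrict measurableSet_ball.compl, inter_comm, ← Set.sdiff_eq] at h1
    exact h1
  · have h2 := tendsto_integral_even_weight hBD hF hFm hw (fun η hη => ⟨_, hwM η hη⟩) hwe hwle
      (fun z hz => ?_) hd
    · refine h2.congr fun η => ?_
      rw [heq, setIntegral_indicator measurableSet_ball.compl, ← Set.sdiff_eq]
    · refine tendsto_const_nhds.congr' ?_
      have : Iio ‖z‖ ∈ 𝓝[>] (0 : ℝ) := nhdsWithin_le_nhds (Iio_mem_nhds (norm_pos_iff.2 hz))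
      filter_upwards [this] with η hη
      simp only [hW]
      rw [indicator_of_mem]
      rw [mem_compl_iff, mem_ball_zero_iff, not_lt]
      exact le_of_lt hη

theorem tendsto_integral_regularised
    (hBD : Metric.ball x r ⊆ D) {m : ℝ} (hm : 0 ≤ m)
    (hF : IntegrableOn (fun y => linearCorrected F l x r y * ‖y - x‖ ^ (-(2 * m))) D)
    (hFm : Measurable F) (hd : 1 ≤ d) :
    (∀ η : ℝ, 0 < η → IntegrableOn (fun y => F y * (‖y - x‖ ^ 2 + η ^ 2) ^ (-m)) D) ∧
    Tendsto (fun η : ℝ => ∫ y in D, F y * (‖y - x‖ ^ 2 + η ^ 2) ^ (-m)) (𝓝[>] 0)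
      (𝓝 (∫ y in D, linearCorrected F l x r y * ‖y - x‖ ^ (-(2 * m)))) := by
  set W : ℝ → EuclideanSpace ℝ (Fin d) → ℝ := fun η z => (‖z‖ ^ 2 + η ^ 2) ^ (-m) with hW
  have hw : ∀ η, Measurable (W η) := fun η => by simp only [hW]; fun_prop
  have hwn : ∀ η z, 0 ≤ W η z := fun η z => by positivity
  have hwM : ∀ η, 0 < η → ∀ z, |W η z| ≤ (η ^ 2) ^ (-m) := by
    intro η hη z
    rw [abs_of_nonneg (hwn η z)]
    exact Real.rpow_le_rpow_of_nonpos (by positivity) (by nlinarith [norm_nonneg z]) (by linarith)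
  have hsq : ∀ z : EuclideanSpace ℝ (Fin d), ‖z‖ ^ (-(2 * m)) = (‖z‖ ^ 2) ^ (-m) := by
    intro z
    rw [← Real.rpow_natCast, ← Real.rpow_mul (norm_nonneg z)]
    congr 1; push_cast; ring
  have hwe : ∀ η z, W η (-z) = W η z := fun η z => by simp only [hW, norm_neg]
  have hwle : ∀ η, 0 < η → ∀ z ≠ 0, |W η z| ≤ ‖z‖ ^ (-(2 * m)) := by
    intro η hη z hz
    have hz' := norm_pos_iff.2 hz
    rw [abs_of_nonneg (hwn η z), hsq]
    exact Real.rpow_le_rpow_of_nonpos (by positivity) (by nlinarith [sq_nonneg η]) (by linarith)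
  refine ⟨fun η hη => (integral_mul_even_weight hBD hF hFm (hw η) (hwM η hη) (hwe η)
    (hwle η hη) hd).1, tendsto_integral_even_weight hBD hF hFm hw (fun η hη => ⟨_, hwM η hη⟩)
    hwe hwle (fun z hz => ?_) hd⟩
  have hz' := norm_pos_iff.2 hz
  have hc : ContinuousAt (fun η : ℝ => W η z) 0 :=
    ContinuousAt.rpow_const (by fun_prop) (Or.inl (by positivity))
  have h3 := hc.tendsto.mono_left (nhdsWithin_le_nhds (s := Ioi 0))
  rw [hsq]
  simpa [hW] using h3

end PrincipalValue

/-! ### Integrability after removing the linear part -/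

/-- The mean value inequality is applied twice, on an interval where `σ ≥ h/2`. The constant may
depend on `h`: it serves only the existence of the principal value, not the final estimate. -/
theorem exists_abs_rpow_taylor_le {p h : ℝ} (hp : 0 < p) (hp2 : p ≤ 2) (hh : 0 < h) :
    ∃ C, 0 ≤ C ∧ ∀ t, |t - h| ≤ h / 2 →
      |t ^ p - h ^ p - p * h ^ (p - 1) * (t - h)| ≤ C * |t - h| ^ 2 := by
  set K := |p - 1| * (h / 2) ^ (p - 2) with hK
  refine ⟨p * K, by positivity, fun t ht => ?_⟩
  set s := Metric.closedBall h |t - h| with hs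
  have hlow : ∀ σ ∈ s, h / 2 ≤ σ := by
    intro σ hσ
    rw [hs, mem_closedBall_iff_norm, Real.norm_eq_abs] at hσ
    have := (abs_le.1 (hσ.trans ht)).1
    linarith
  have hhs : h ∈ s := Metric.mem_closedBall_self (abs_nonneg _)
  have hts : t ∈ s := by rw [hs, mem_closedBall_iff_norm, Real.norm_eq_abs]
  have hconv : Convex ℝ s := convex_closedBall _ _
  have h1 : ∀ σ ∈ s, |σ ^ (p - 1) - h ^ (p - 1)| ≤ K * |t - h| := by
    intro σ hσ
    have h2 := hconv.norm_image_sub_le_of_norm_hasDerivWithin_le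
      (f := fun σ : ℝ => σ ^ (p - 1)) (f' := fun σ => (p - 1) * σ ^ (p - 1 - 1)) (C := K)
      (fun τ hτ => (Real.hasDerivAt_rpow_const
        (Or.inl (by have := hlow τ hτ; linarith))).hasDerivWithinAt)
      (fun τ hτ => ?_) hhs hσ
    · refine h2.trans ?_
      rw [hs, mem_closedBall_iff_norm] at hσ
      gcongr
    · rw [norm_mul, Real.norm_eq_abs, Real.norm_of_nonneg (Real.rpow_nonneg
        (by have := hlow τ hτ; linarith) _), hK, show p - 1 - 1 = p - 2 by ring]
      gcongr ?_ * ?_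
      exact Real.rpow_le_rpow_of_nonpos (by positivity) (hlow τ hτ) (by linarith)
  have h3 := hconv.norm_image_sub_le_of_norm_hasDerivWithin_le
    (f := fun σ : ℝ => σ ^ p - p * h ^ (p - 1) * σ)
    (f' := fun σ => p * σ ^ (p - 1) - p * h ^ (p - 1) * 1) (C := p * (K * |t - h|))
    (fun τ hτ => ((Real.hasDerivAt_rpow_const
      (Or.inl (by have := hlow τ hτ; linarith))).sub
        ((hasDerivAt_id τ).const_mul _)).hasDerivWithinAt)
    (fun τ hτ => ?_) hhs hts
  · rw [Real.norm_eq_abs, Real.norm_eq_abs] at h3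
    calc |t ^ p - h ^ p - p * h ^ (p - 1) * (t - h)|
        = |t ^ p - p * h ^ (p - 1) * t - (h ^ p - p * h ^ (p - 1) * h)| := by ring_nf
      _ ≤ p * (K * |t - h|) * |t - h| := h3
      _ = _ := by ring
  · rw [mul_one, ← mul_sub, norm_mul, Real.norm_of_nonneg hp.le, Real.norm_eq_abs]
    gcongr
    exact h1 τ hτ

/-- The linear function `z ↦ c (z_d - ⟨a, z̃⟩)`. -/
noncomputable def slantedFunctional {n : ℕ} (c : ℝ) (a : EuclideanSpace ℝ (Fin n)) :
    EuclideanSpace ℝ (Fin (n + 1)) →L[ℝ] ℝ :=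
  LinearMap.toContinuousLinearMap
    { toFun := fun z => c * (height z - inner ℝ a (tangential z))
      map_add' := fun y z => by
        have h1 : tangential (y + z) = tangential y + tangential z := by ext i; simp [tangential]
        have h2 : height (y + z) = height y + height z := by simp [height]
        rw [h1, h2, inner_add_right]; ring
      map_smul' := fun b z => by
        have h1 : tangential (b • z) = b • tangential z := by ext i; simp [tangential]
        have h2 : height (b • z) = b * height z := by simp [height]
        rw [h1, h2, inner_smul_right]; simp; ring }

theorem slantedFunctional_apply {n : ℕ} (c : ℝ) (a : EuclideanSpace ℝ (Fin n))
    (z : EuclideanSpace ℝ (Fin (n + 1))) :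
    slantedFunctional c a z = c * (height z - inner ℝ a (tangential z)) := rfl

section

variable {n : ℕ} {α β Λ p : ℝ} {G : EuclideanSpace ℝ (Fin n) → ℝ}
  {x : EuclideanSpace ℝ (Fin (n + 1))}

/-- The signed vertical distance is `(1 + Λ)`-Lipschitz, so on this radius it changes by at most
half its value at `x`. -/
theorem IsC1Holder.near_of_mem_ball (hG : IsC1Holder β Λ G) (hΛ : 0 ≤ Λ) (hx : x ∈ aboveGraph G)
    {y : EuclideanSpace ℝ (Fin (n + 1))}
    (hy : y ∈ Metric.ball x (vertDist G x / (2 * (1 + Λ)))) :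
    y ∈ aboveGraph G ∧ |vertDist G y - vertDist G x| ≤ vertDist G x / 2 ∧
      |vertDist G y - vertDist G x| ≤ (1 + Λ) * ‖y - x‖ := by
  obtain ⟨h1, h2⟩ := vertDist_eq hx
  have h3 := hG.abs_height_sub_le hΛ x y
  rw [mem_ball_iff_norm, lt_div_iff₀ (by positivity)] at hy
  have h4 : (1 + Λ) * ‖y - x‖ < vertDist G x / 2 := by linarith
  have h5 := (abs_le.1 (h3.trans h4.le)).1
  have hyD : y ∈ aboveGraph G := by
    change G (tangential y) < height y
    linarith
  rw [← h1, ← (vertDist_eq hyD).1] at h3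
  exact ⟨hyD, h3.trans h4.le, h3⟩

/-- Two expansions combine: the quadratic remainder of `t ↦ t^p` and the `C^{1,β}` remainder of `G`.
On a bounded ball the former is absorbed because `1 + β ≤ 2`. -/
theorem IsC1Holder.exists_linearCorrected_near_le (hG : IsC1Holder β Λ G) (hΛ : 0 ≤ Λ)
    (hβ0 : 0 < β) (hβ1 : β ≤ 1) (hp : 0 < p) (hp2 : p ≤ 2) (hx : x ∈ aboveGraph G) :
    ∃ C, 0 ≤ C ∧ ∀ y ∈ Metric.ball x (vertDist G x / (2 * (1 + Λ))),
      |vertDist G y ^ p - vertDist G x ^ p -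
        slantedFunctional (p * vertDist G x ^ (p - 1)) (gradient G (tangential x)) (y - x)| ≤
        C * ‖y - x‖ ^ (1 + β) := by
  obtain ⟨h1, h2⟩ := vertDist_eq hx
  set h := vertDist G x with hh
  set r := h / (2 * (1 + Λ)) with hr
  have hr0 : 0 < r := by positivity
  obtain ⟨C, hC0, hC⟩ := exists_abs_rpow_taylor_le hp hp2 h2
  refine ⟨C * (1 + Λ) ^ 2 * r ^ (1 - β) + p * h ^ (p - 1) * Λ, by positivity, fun y hy => ?_⟩
  obtain ⟨hyD, hy1, hy2⟩ := hG.near_of_mem_ball hΛ hx hy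
  have hyr : ‖y - x‖ ≤ r := (mem_ball_iff_norm.1 hy).le
  have h3 := hC _ hy1
  have h4 := hG.abs_sub_sub_inner_le hΛ hβ0 (tangential x) (tangential y - tangential x)
  rw [add_sub_cancel, ← tangential_sub] at h4
  have h5 : vertDist G y - h - (height (y - x) - inner ℝ (gradient G (tangential x))
      (tangential (y - x))) = -(G (tangential y) - G (tangential x) -
        inner ℝ (gradient G (tangential x)) (tangential (y - x))) := by
    rw [(vertDist_eq hyD).1, h1, height_sub]; ring
  have h6 : vertDist G y ^ p - h ^ p -
      slantedFunctional (p * h ^ (p - 1)) (gradient G (tangential x)) (y - x) =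
      (vertDist G y ^ p - h ^ p - p * h ^ (p - 1) * (vertDist G y - h)) +
      p * h ^ (p - 1) * (vertDist G y - h - (height (y - x) - inner ℝ (gradient G (tangential x))
        (tangential (y - x)))) := by
    rw [slantedFunctional_apply]; ring
  have h7 : ‖y - x‖ ^ 2 ≤ r ^ (1 - β) * ‖y - x‖ ^ (1 + β) := by
    have : ‖y - x‖ ^ 2 = ‖y - x‖ ^ (1 - β) * ‖y - x‖ ^ (1 + β) := by
      rw [← Real.rpow_add' (norm_nonneg _) (by norm_num), ← Real.rpow_natCast]
      congr 1; push_cast; ring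
    rw [this]
    gcongr
  have h8 : ‖tangential (y - x)‖ ^ (1 + β) ≤ ‖y - x‖ ^ (1 + β) := by
    gcongr
    exact norm_tangential_le _
  rw [h6, h5]
  refine (abs_add_le _ _).trans ?_
  rw [abs_mul, abs_neg, abs_of_nonneg (by positivity : 0 ≤ p * h ^ (p - 1)), add_mul]
  refine add_le_add ?_ ?_
  · calc _ ≤ C * |vertDist G y - h| ^ 2 := h3
      _ ≤ C * ((1 + Λ) * ‖y - x‖) ^ 2 := by gcongr
      _ = C * (1 + Λ) ^ 2 * ‖y - x‖ ^ 2 := by ring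
      _ ≤ C * (1 + Λ) ^ 2 * (r ^ (1 - β) * ‖y - x‖ ^ (1 + β)) := by gcongr
      _ = _ := by ring
  · calc _ ≤ p * h ^ (p - 1) * (Λ * ‖tangential (y - x)‖ ^ (1 + β)) := by gcongr
      _ ≤ p * h ^ (p - 1) * (Λ * ‖y - x‖ ^ (1 + β)) := by gcongr
      _ = _ := by ring

theorem IsC1Holder.exists_far_le (hG : IsC1Holder β Λ G) (hΛ : 0 ≤ Λ) (hp : 0 < p)
    (hx : x ∈ aboveGraph G) :
    ∃ C, 0 ≤ C ∧ ∀ y ∈ aboveGraph G,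
      |vertDist G y ^ p - vertDist G x ^ p| ≤ C * (1 + ‖y - x‖) ^ p := by
  obtain ⟨h1, h2⟩ := vertDist_eq hx
  set h := vertDist G x with hh
  refine ⟨(h + (1 + Λ)) ^ p, by positivity, fun y hy => ?_⟩
  obtain ⟨h3, h4⟩ := vertDist_eq hy
  have h5 := hG.abs_height_sub_le hΛ x y
  rw [← h1, ← h3] at h5
  have h6 := (abs_le.1 h5).2
  have hn := norm_nonneg (y - x)
  have h7 : vertDist G y ≤ (h + (1 + Λ)) * (1 + ‖y - x‖) := by nlinarith
  have h8 : h ≤ (h + (1 + Λ)) * (1 + ‖y - x‖) := by nlinarith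
  rw [← Real.mul_rpow (by positivity) (by positivity)]
  have h9 := Real.rpow_le_rpow h4.le h7 hp.le
  have h10 := Real.rpow_le_rpow h2.le h8 hp.le
  have h11 := Real.rpow_nonneg h4.le p
  have h12 := Real.rpow_nonneg h2.le p
  rw [abs_le]
  constructor <;> linarith

/-- Near `x` the corrected integrand is `O(‖z‖^(1+β-α-(n+1)))`, integrable since `β > α - 1`; away
from `x` it is `O((1 + ‖z‖)^(p-α-(n+1)))`, integrable since `p < α`. -/
theorem IsC1Holder.integrableOn_linearCorrected (hG : IsC1Holder β Λ G) (hΛ : 0 ≤ Λ)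
    (hβ0 : 0 < β) (hβ1 : β ≤ 1) (hα2 : α < 2) (hαβ : α - 1 < β) (hp : 0 < p) (hpα : p < α)
    (hx : x ∈ aboveGraph G) :
    IntegrableOn (fun y => linearCorrected (fun y => vertDist G y ^ p - vertDist G x ^ p)
      (slantedFunctional (p * vertDist G x ^ (p - 1)) (gradient G (tangential x))) x
      (vertDist G x / (2 * (1 + Λ))) y * ‖y - x‖ ^ (-(2 * (((n : ℝ) + 1 + α) / 2))))
      (aboveGraph G) := by
  have h2 := (vertDist_eq hx).2
  obtain ⟨C, hC0, hC⟩ := hG.exists_linearCorrected_near_le hΛ hβ0 hβ1 hp (by linarith) hx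
  obtain ⟨C', hC'0, hC'⟩ := hG.exists_far_le hΛ hp hx
  set r := vertDist G x / (2 * (1 + Λ)) with hr
  have hr0 : 0 < r := by positivity
  set l := slantedFunctional (p * vertDist G x ^ (p - 1)) (gradient G (tangential x)) with hl
  have he : -(2 * (((n : ℝ) + 1 + α) / 2)) = -((n : ℝ) + 1 + α) := by ring
  rw [he]
  set b := (n : ℝ) + 1 + α with hb
  have hn0 : (0 : ℝ) ≤ n := n.cast_nonneg
  have hb0 : 0 < b := by linarith
  set k₁ : EuclideanSpace ℝ (Fin (n + 1)) → ℝ := (Metric.ball 0 r).indicator fun z => C * ‖z‖ ^ (1 + β - b) with hk₁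
  set k₂ : EuclideanSpace ℝ (Fin (n + 1)) → ℝ := fun z => C' * (1 / r + 1) ^ b * (1 + ‖z‖) ^ (-(b - p)) with hk₂
  have i₁ : Integrable k₁ := by
    refine IntegrableOn.integrable_indicator ?_ measurableSet_ball
    refine integrableOn_ball_of_norm_le_rpow (C := C) (α := b - 1 - β) (by simp) ?_ ?_ ?_
    · simp only [finrank_euclideanSpace, Fintype.card_fin]
      push_cast
      linarith
    · refine Eventually.of_forall fun z => ?_
      rw [Real.norm_of_nonneg (by positivity)]
      refine le_of_eq ?_
      ring_nf
    · exact Measurable.aestronglyMeasurable (by fun_prop)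
  have i₂ : Integrable k₂ := by
    refine (integrable_one_add_norm ?_).const_mul _
    simp only [finrank_euclideanSpace, Fintype.card_fin]
    push_cast
    linarith
  have n₁ : ∀ z, 0 ≤ k₁ z := fun z => indicator_nonneg (fun z _ => by positivity) z
  have n₂ : ∀ z, 0 ≤ k₂ z := fun z => by positivity
  have hGc := hG.differentiable.continuous
  have hNm : Measurable fun y => linearCorrected (fun y => vertDist G y ^ p - vertDist G x ^ p)
      l x r y * ‖y - x‖ ^ (-b) := by
    refine Measurable.mul (Measurable.sub ?_ (Measurable.indicator ?_ measurableSet_ball))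
      (by fun_prop)
    · exact ((continuous_vertDist hGc).measurable.pow_const p).sub_const _
    · exact (l.continuous.comp (continuous_id.sub continuous_const)).measurable
  refine Integrable.mono' ((i₁.add i₂).comp_sub_right x).integrableOn hNm.aestronglyMeasurable ?_
  have h4 : ∀ᵐ y ∂(volume : Measure (EuclideanSpace ℝ (Fin (n + 1)))), y ≠ x := by rw [ae_iff]; simp
  filter_upwards [ae_restrict_mem (measurableSet_aboveGraph hGc), ae_restrict_of_ae h4] with y hy hyx
  have hyx' : 0 < ‖y - x‖ := norm_pos_iff.2 (sub_ne_zero.2 hyx)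
  rw [norm_mul, Real.norm_eq_abs, Real.norm_of_nonneg (by positivity), Pi.add_apply]
  have m₁ := n₁ (y - x)
  have m₂ := n₂ (y - x)
  by_cases hB : y ∈ Metric.ball x r
  · have h5 : k₁ (y - x) = C * ‖y - x‖ ^ (1 + β - b) := by
      rw [hk₁, indicator_of_mem]
      rwa [mem_ball_zero_iff, ← mem_ball_iff_norm]
    have h6 := hC y hB
    simp only [linearCorrected, indicator_of_mem hB]
    calc _ ≤ C * ‖y - x‖ ^ (1 + β) * ‖y - x‖ ^ (-b) := by gcongr
      _ = C * ‖y - x‖ ^ (1 + β - b) := by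
        rw [mul_assoc, ← Real.rpow_add hyx']; ring_nf
      _ ≤ _ := by linarith
  · have h6 := hC' y hy
    simp only [linearCorrected, indicator_of_notMem hB, sub_zero]
    rw [mem_ball_iff_norm, not_lt] at hB
    have h7 : ‖y - x‖ ^ (-b) ≤ (1 / r + 1) ^ b * (1 + ‖y - x‖) ^ (-b) := by
      have h8 : (1 / r + 1) ^ b = ((1 / r + 1)⁻¹) ^ (-b) := by
        rw [Real.inv_rpow (by positivity), Real.rpow_neg (by positivity), inv_inv]
      rw [h8, ← Real.mul_rpow (by positivity) (by positivity)]
      refine Real.rpow_le_rpow_of_nonpos (by positivity) ?_ (by linarith)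
      rw [inv_mul_le_iff₀ (by positivity)]
      have : 1 ≤ 1 / r * ‖y - x‖ := by
        rw [one_div, ← div_eq_inv_mul, one_le_div hr0]; exact hB
      linarith
    calc _ ≤ C' * (1 + ‖y - x‖) ^ p * ((1 / r + 1) ^ b * (1 + ‖y - x‖) ^ (-b)) := by gcongr
      _ = C' * (1 / r + 1) ^ b * ((1 + ‖y - x‖) ^ p * (1 + ‖y - x‖) ^ (-b)) := by ring
      _ = k₂ (y - x) := by
        rw [← Real.rpow_add (by positivity)]
        simp only [hk₂]
        ring_nf
      _ ≤ _ := by linarith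

end

/-! ### Distance to the complement versus vertical distance -/

section Distance

variable {n : ℕ} {β Λ : ℝ} {G : EuclideanSpace ℝ (Fin n) → ℝ}
  {x : EuclideanSpace ℝ (Fin (n + 1))}

theorem exists_coords (u : EuclideanSpace ℝ (Fin n)) (t : ℝ) :
    ∃ y : EuclideanSpace ℝ (Fin (n + 1)), tangential y = u ∧ height y = t := by
  refine ⟨(splitEquiv n).symm (u, t), ?_⟩
  have h := splitEquiv_apply ((splitEquiv n).symm (u, t))
  rw [MeasurableEquiv.apply_symm_apply] at h
  exact ⟨(congrArg Prod.fst h).symm, (congrArg Prod.snd h).symm⟩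

theorem notMem_aboveGraph {y : EuclideanSpace ℝ (Fin (n + 1))} :
    y ∈ (aboveGraph G)ᶜ ↔ height y ≤ G (tangential y) := by
  simp [aboveGraph]

theorem aboveGraph_compl_nonempty : (aboveGraph G)ᶜ.Nonempty := by
  obtain ⟨y, h1, h2⟩ := exists_coords (0 : EuclideanSpace ℝ (Fin n)) (G 0)
  exact ⟨y, notMem_aboveGraph.2 (by rw [h1, h2])⟩

theorem IsC1Holder.div_le_infDist (hG : IsC1Holder β Λ G) (hΛ : 0 ≤ Λ) (hx : x ∈ aboveGraph G) :
    vertDist G x / (1 + Λ) ≤ Metric.infDist x (aboveGraph G)ᶜ := by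
  rw [Metric.le_infDist aboveGraph_compl_nonempty]
  intro y hy
  rw [notMem_aboveGraph] at hy
  obtain ⟨h1, h2⟩ := vertDist_eq hx
  have h3 := (abs_le.1 (hG.abs_height_sub_le hΛ x y)).1
  rw [dist_comm, dist_eq_norm, div_le_iff₀ (by positivity)]
  linarith

theorem infDist_le_vertDist (hx : x ∈ aboveGraph G) :
    Metric.infDist x (aboveGraph G)ᶜ ≤ vertDist G x := by
  obtain ⟨y, h1, h2⟩ := exists_coords (tangential x) (G (tangential x))
  obtain ⟨h3, h4⟩ := vertDist_eq hx
  refine (Metric.infDist_le_dist_of_mem (notMem_aboveGraph.2 (by rw [h1, h2]))).trans ?_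
  rw [dist_eq_norm]
  refine le_of_sq_le_sq ?_ h4.le
  rw [norm_sq_eq_tangential_add_height, tangential_sub, height_sub, h1, h2, h3]
  simp

/-- The quotient `h/c` is the distance from `x` to the tangent plane above `x̃`, and within
horizontal distance `h` of `x̃` the graph stays within `Λ h^(1+β)` of that plane. -/
theorem IsC1Holder.abs_infDist_sub_le (hG : IsC1Holder β Λ G) (hΛ : 0 ≤ Λ) (hβ : 0 < β)
    (hx : x ∈ aboveGraph G) :
    |Metric.infDist x (aboveGraph G)ᶜ -
      vertDist G x / √(1 + ‖gradient G (tangential x)‖ ^ 2)| ≤ Λ * vertDist G x ^ (1 + β) := by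
  obtain ⟨h1, h2⟩ := vertDist_eq hx
  set h := vertDist G x with hh
  set a := gradient G (tangential x) with ha
  set c := √(1 + ‖a‖ ^ 2) with hc
  have hc2 : c ^ 2 = 1 + ‖a‖ ^ 2 := Real.sq_sqrt (by positivity)
  have hc1 : 1 ≤ c := Real.one_le_sqrt.2 (by nlinarith [norm_nonneg a])
  have hc0 : 0 < c := by linarith
  have hT : ∀ u : EuclideanSpace ℝ (Fin n), ‖u‖ ≤ h →
      |G (tangential x + u) - G (tangential x) - inner ℝ a u| ≤ Λ * h ^ (1 + β) := by
    intro u hu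
    refine (hG.abs_sub_sub_inner_le hΛ hβ (tangential x) u).trans ?_
    gcongr
  have hE0 : 0 ≤ Λ * h ^ (1 + β) := by positivity
  rw [abs_le]
  constructor
  · have h3 : h / c - Λ * h ^ (1 + β) ≤ Metric.infDist x (aboveGraph G)ᶜ := by
      rw [Metric.le_infDist aboveGraph_compl_nonempty]
      intro y hy
      rw [notMem_aboveGraph] at hy
      rw [dist_comm, dist_eq_norm]
      rcases le_total h ‖y - x‖ with h4 | h4
      · have : h / c ≤ h := div_le_self h2.le hc1
        linarith
      · set u := tangential y - tangential x with hu
        have h5 : ‖u‖ ≤ ‖y - x‖ := by rw [hu, ← tangential_sub]; exact norm_tangential_le _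
        have h6 := (abs_le.1 (hT u (h5.trans h4))).2
        rw [hu, add_sub_cancel, ← hu] at h6
        have h7 : h - Λ * h ^ (1 + β) ≤ inner ℝ a u - height (y - x) := by
          rw [height_sub]; linarith
        -- Cauchy–Schwarz against the normal vector `(a, -1)`, whose norm is `c`.
        have h8 : inner ℝ a u - height (y - x) ≤ c * ‖y - x‖ := by
          refine le_of_sq_le_sq ?_ (by positivity)
          rw [mul_pow, hc2, norm_sq_eq_tangential_add_height, tangential_sub, ← hu]
          have h9 := sq_le_sq' (by linarith [neg_abs_le (inner ℝ a u), abs_real_inner_le_norm a u])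
            (real_inner_le_norm a u)
          have h10 := abs_real_inner_le_norm a u
          have h11 : -(2 * inner ℝ a u * height (y - x)) ≤
              2 * (‖a‖ * ‖u‖) * |height (y - x)| := by
            have := neg_abs_le (inner ℝ a u * height (y - x))
            rw [abs_mul] at this
            have h12 := mul_le_mul_of_nonneg_right h10 (abs_nonneg (height (y - x)))
            linarith
          nlinarith [sq_nonneg (‖a‖ * |height (y - x)| - ‖u‖), sq_abs (height (y - x))]
        have h9 : (h - Λ * h ^ (1 + β)) / c ≤ ‖y - x‖ := by
          rw [div_le_iff₀ hc0]; linarith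
        have h10 : Λ * h ^ (1 + β) / c ≤ Λ * h ^ (1 + β) := div_le_self hE0 hc1
        rw [sub_div] at h9
        linarith
    linarith
  -- `u` is the horizontal displacement from `x` to its orthogonal projection `w` on the tangent
  -- plane; `y` is the graph point on the same vertical line as `w`.
  · set u := (h / c ^ 2) • a with hu
    have hun : ‖u‖ = h / c ^ 2 * ‖a‖ := by
      rw [hu, norm_smul, Real.norm_of_nonneg (by positivity)]
    have huh : ‖u‖ ≤ h := by
      rw [hun, div_mul_eq_mul_div, div_le_iff₀ (by positivity), hc2]
      have : ‖a‖ ≤ 1 + ‖a‖ ^ 2 := by nlinarith [sq_nonneg (‖a‖ - 1)]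
      gcongr
    obtain ⟨y, hy1, hy2⟩ := exists_coords (tangential x + u) (G (tangential x + u))
    obtain ⟨w, hw1, hw2⟩ := exists_coords (tangential x + u) (height x - h + inner ℝ a u)
    have h3 : Metric.infDist x (aboveGraph G)ᶜ ≤ dist x w + dist w y :=
      (Metric.infDist_le_dist_of_mem (notMem_aboveGraph.2 (by rw [hy1, hy2]))).trans
        (dist_triangle _ _ _)
    have h4 : dist x w ≤ h / c := by
      rw [dist_comm, dist_eq_norm]
      refine le_of_sq_le_sq (le_of_eq ?_) (by positivity)
      rw [norm_sq_eq_tangential_add_height, tangential_sub, height_sub, hw1, hw2,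
        add_sub_cancel_left, hun, hu, inner_smul_right, real_inner_self_eq_norm_sq, div_pow,
        show ‖a‖ ^ 2 = c ^ 2 - 1 by linarith, mul_pow, show ‖a‖ ^ 2 = c ^ 2 - 1 by linarith]
      field_simp
      ring
    have h5 : dist w y ≤ Λ * h ^ (1 + β) := by
      rw [dist_comm, dist_eq_norm]
      refine le_of_sq_le_sq ?_ hE0
      rw [norm_sq_eq_tangential_add_height, tangential_sub, height_sub, hw1, hw2, hy1, hy2,
        sub_self, norm_zero]
      have h6 := hT u huh
      have h7 : G (tangential x + u) - (height x - h + inner ℝ a u) =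
        G (tangential x + u) - G (tangential x) - inner ℝ a u := by rw [h1]; ring
      rw [h7]
      have := sq_le_sq' (by linarith [(abs_le.1 h6).1]) (abs_le.1 h6).2
      linarith
    linarith

theorem IsC1Holder.abs_rpow_infDist_sub_le (hG : IsC1Holder β Λ G) (hΛ : 0 ≤ Λ) (hβ : 0 < β)
    (hx : x ∈ aboveGraph G) {α : ℝ} (hα : 0 ≤ α) (p : ℝ) :
    |vertDist G x ^ p * (vertDist G x / √(1 + ‖gradient G (tangential x)‖ ^ 2)) ^ (-α) -
      vertDist G x ^ p * Metric.infDist x (aboveGraph G)ᶜ ^ (-α)| ≤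
      α * (1 + Λ) ^ (α + 1) * Λ * vertDist G x ^ (p - α + β) := by
  have h1 := hG.abs_infDist_sub_le hΛ hβ hx
  have h2 := hG.div_le_infDist hΛ hx
  have h3 := (vertDist_eq hx).2
  set h := vertDist G x with hh
  set a := gradient G (tangential x) with ha
  have hc : √(1 + ‖a‖ ^ 2) ≤ 1 + Λ := by
    rw [Real.sqrt_le_left (by positivity)]
    have := hG.gradient_le (tangential x)
    nlinarith [norm_nonneg a]
  have h4 : h / (1 + Λ) ≤ h / √(1 + ‖a‖ ^ 2) := by gcongr
  have h5 := abs_rpow_neg_sub_rpow_neg_le (by positivity) h4 h2 hα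
  have h6 : (h / (1 + Λ)) ^ (-α - 1) = (1 + Λ) ^ (α + 1) * h ^ (-α - 1) := by
    rw [Real.div_rpow h3.le (by positivity), show -α - 1 = -(α + 1) by ring,
      Real.rpow_neg (by positivity : 0 ≤ 1 + Λ), div_inv_eq_mul, mul_comm]
  have h7 : h ^ (p - α + β) = h ^ p * h ^ (-α - 1) * h ^ (1 + β) := by
    rw [← Real.rpow_add h3, ← Real.rpow_add h3]; ring_nf
  rw [← mul_sub, abs_mul, abs_of_pos (Real.rpow_pos_of_pos h3 p)]
  rw [abs_sub_comm] at h1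
  calc _ ≤ h ^ p * (α * ((1 + Λ) ^ (α + 1) * h ^ (-α - 1)) * (Λ * h ^ (1 + β))) := by
        rw [← h6]
        have : 0 ≤ α * (h / (1 + Λ)) ^ (-α - 1) := by positivity
        gcongr
        exact h5.trans (by gcongr)
    _ = _ := by rw [h7]; ring

/-- Since `δ` and `h` agree up to the factor `1 + Λ`, their powers agree up to `(1 + Λ)^|q|` for
either sign of `q`, and their logarithms up to `log (1 + Λ)`. -/
theorem error_le_of_comparable {h δ q : ℝ} (hΛ : 0 ≤ Λ) (hh : 0 < h) (hδ : h / (1 + Λ) ≤ δ)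
    (hδh : δ ≤ h) :
    1 + h ^ q + |Real.log h| ≤
      ((1 + Λ) ^ |q| + 1 + Real.log (1 + Λ)) * (1 + δ ^ q + |Real.log δ|) := by
  have hM : 1 ≤ 1 + Λ := by linarith
  have hM0 : 0 < 1 + Λ := by linarith
  have hδ0 : 0 < δ := lt_of_lt_of_le (by positivity) hδ
  have hδ' : h ≤ δ * (1 + Λ) := by rwa [div_le_iff₀ hM0] at hδ
  have h1 : h ^ q ≤ (1 + Λ) ^ |q| * δ ^ q := by
    rcases le_total 0 q with hq | hq
    · rw [abs_of_nonneg hq, mul_comm, ← Real.mul_rpow hδ0.le hM0.le]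
      exact Real.rpow_le_rpow hh.le hδ' hq
    · have h2 : h ^ q ≤ δ ^ q := Real.rpow_le_rpow_of_nonpos hδ0 hδh hq
      have h3 : 1 ≤ (1 + Λ) ^ |q| := Real.one_le_rpow hM (abs_nonneg q)
      have h4 : 0 < δ ^ q := Real.rpow_pos_of_pos hδ0 q
      nlinarith
  have hlM : 0 ≤ Real.log (1 + Λ) := Real.log_nonneg hM
  have h2 : |Real.log h| ≤ |Real.log δ| + Real.log (1 + Λ) := by
    have h3 : Real.log δ ≤ Real.log h := Real.log_le_log hδ0 hδh
    have h4 : Real.log h ≤ Real.log δ + Real.log (1 + Λ) := by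
      rw [← Real.log_mul hδ0.ne' hM0.ne']
      exact Real.log_le_log hh hδ'
    rw [abs_le]
    constructor
    · linarith [neg_abs_le (Real.log δ)]
    · linarith [le_abs_self (Real.log δ)]
  have h3 : 0 < δ ^ q := Real.rpow_pos_of_pos hδ0 q
  have h4 := abs_nonneg (Real.log δ)
  have h5 : 0 < (1 + Λ) ^ |q| := Real.rpow_pos_of_pos hM0 _
  nlinarith [mul_nonneg h5.le h4, mul_nonneg hlM h4, mul_nonneg hlM h3.le]

end Distance

/-! ### Replacing the graph by its tangent plane -/

section Comparison

variable {n : ℕ} {φ ψ : EuclideanSpace ℝ (Fin n) → ℝ} {α β Λ p : ℝ}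

theorem integrableOn_profile_mul_slabKernel (hp : 0 < p) (hpα : p < α)
    (hφc : Continuous φ) (hφ : ∀ u, |φ u| ≤ Λ * ‖u‖) {h η : ℝ} (hh : 0 < h) (hη : 0 < η) :
    IntegrableOn (fun t => (t ^ p - h ^ p) * slabKernel φ (((n : ℝ) + 1 + α) / 2) η (t - h))
      (Ioi 0) := by
  have hm : (n : ℝ) / 2 < ((n : ℝ) + 1 + α) / 2 := by linarith
  set m := ((n : ℝ) + 1 + α) / 2 with hmd
  have he : (n : ℝ) / 2 - m = -((1 + α) / 2) := by rw [hmd]; ring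
  have hsm : Measurable (slabKernel φ m η) := by
    have h1 := (continuous_slanted_kernel (m := m) hφc hη).stronglyMeasurable
    exact (StronglyMeasurable.integral_prod_left
      (f := fun (u : EuclideanSpace ℝ (Fin n)) (s : ℝ) =>
        (‖u‖ ^ 2 + (s + φ u) ^ 2 + η ^ 2) ^ (-m)) (μ := volume) h1).measurable
  refine Integrable.mono' ((integrableOn_profile hp hpα hh hη).const_mul
    ((2 + 2 * Λ ^ 2) ^ m * bracketIntegral n m)) ?_ ?_
  · exact (((measurable_id.pow_const p).sub_const _).mul
      (hsm.comp (measurable_id.sub_const h))).aestronglyMeasurable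
  · refine (ae_restrict_mem measurableSet_Ioi).mono fun t ht => ?_
    have ht : 0 < t := ht
    have h1 := slabKernel_le hm hφc hφ hη (t - h)
    rw [he] at h1
    rw [norm_mul, Real.norm_of_nonneg (slabKernel_nonneg η (t - h)), Real.norm_eq_abs]
    have h2 : |t ^ p - h ^ p| ≤ t ^ p + h ^ p := by
      have h3 := Real.rpow_pos_of_pos ht p
      have h4 := Real.rpow_pos_of_pos hh p
      rw [abs_le]; constructor <;> linarith
    calc _ ≤ (t ^ p + h ^ p) * ((2 + 2 * Λ ^ 2) ^ m * bracketIntegral n m *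
          ((t - h) ^ 2 + η ^ 2) ^ (-((1 + α) / 2))) :=
        mul_le_mul h2 h1 (slabKernel_nonneg η (t - h)) (by positivity)
      _ = _ := by ring

theorem exists_abs_integral_slabKernel_sub_le (hα : 0 < α) (hα2 : α < 2) (hβα : α - 1 < β)
    (hβ0 : 0 < β) (hβ1 : β ≤ 1) (hp : 0 < p) (hpα : p < α) (hΛ : 0 ≤ Λ) (n : ℕ) {H : ℝ}
    (hH : 0 < H) :
    ∃ C, 0 ≤ C ∧ ∀ φ ψ : EuclideanSpace ℝ (Fin n) → ℝ, Continuous φ → Continuous ψ →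
      (∀ u, |φ u| ≤ Λ * ‖u‖) → (∀ u, |ψ u| ≤ Λ * ‖u‖) →
      (∀ u, |φ u - ψ u| ≤ Λ * ‖u‖ ^ (1 + β)) → ∀ h, 0 < h → h ≤ H → ∀ η, 0 < η →
      |(∫ t in Ioi (0 : ℝ), (t ^ p - h ^ p) *
          slabKernel φ (((n : ℝ) + 1 + α) / 2) η (t - h)) -
        ∫ t in Ioi (0 : ℝ), (t ^ p - h ^ p) *
          slabKernel ψ (((n : ℝ) + 1 + α) / 2) η (t - h)| ≤
        C * (1 + h ^ (p - α + β) + |Real.log h|) := by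
  obtain ⟨C₀, hC₀, hmaj⟩ := exists_profile_majorant hα2 hβα hβ1 hp hpα hH
  have hn0 : (0 : ℝ) ≤ n := n.cast_nonneg
  have hm : (n : ℝ) / 2 < ((n : ℝ) + 1 + α) / 2 := by linarith
  set m := ((n : ℝ) + 1 + α) / 2 with hmd
  set K : ℝ → ℝ → ℝ := fun b l =>
    m * (2 + 2 * Λ ^ 2) ^ (m + 1) * (l * (2 + 2 * Λ)) * bracketIntegral n (m - b / 2) with hK
  have hK0 : ∀ b l, 0 ≤ l → 0 ≤ K b l := fun b l hl => by
    have := bracketIntegral_nonneg n (m - b / 2)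
    have : 0 ≤ m := by linarith
    positivity
  have hK1 := hK0 β Λ hΛ
  have hK2 := hK0 0 (2 * Λ) (by positivity)
  refine ⟨(K β Λ + K 0 (2 * Λ)) * C₀, by positivity, ?_⟩
  intro φ ψ hφc hψc hφ hψ hφψ h hh hhH η hη
  obtain ⟨g, hgi, hgC, hg⟩ := hmaj h hh hhH
  -- The Lipschitz bounds alone amount to the stability estimate with `b = 0` and `l = 2Λ`; this
  -- controls large `|t - h|`.
  have hφψ' : ∀ u, |φ u - ψ u| ≤ 2 * Λ * ‖u‖ ^ (1 + (0 : ℝ)) := by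
    intro u
    rw [add_zero, Real.rpow_one]
    have := abs_sub (φ u) (ψ u)
    have := hφ u
    have := hψ u
    linarith
  rw [← integral_sub (integrableOn_profile_mul_slabKernel hp hpα hφc hφ hh hη)
    (integrableOn_profile_mul_slabKernel hp hpα hψc hψ hh hη), ← Real.norm_eq_abs]
  refine (norm_integral_le_of_norm_le (hgi.const_mul (K β Λ + K 0 (2 * Λ))) ?_).trans ?_
  · have h4 : ∀ᵐ t ∂(volume : Measure ℝ), t ≠ h := by rw [ae_iff]; simp
    filter_upwards [ae_restrict_mem measurableSet_Ioi, ae_restrict_of_ae h4] with t ht hth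
    have hs : t - h ≠ 0 := sub_ne_zero.2 hth
    have e1 : (n : ℝ) - 2 * m + β = -1 - α + β := by rw [hmd]; ring
    have e2 : (n : ℝ) - 2 * m + 0 = -1 - α := by rw [hmd]; ring
    have b1 := abs_slabKernel_sub_le (b := β) hm hΛ hφc hψc hφ hψ hβ0.le
      (by rw [hmd]; linarith) hΛ hφψ hη hs
    have b2 := abs_slabKernel_sub_le (b := 0) hm hΛ hφc hψc hφ hψ le_rfl
      (by rw [hmd]; linarith) (by positivity) hφψ' hη hs
    rw [e1] at b1
    rw [e2] at b2
    have b3 : |slabKernel φ m η (t - h) - slabKernel ψ m η (t - h)| ≤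
        (K β Λ + K 0 (2 * Λ)) * min (|t - h| ^ (-1 - α + β)) (|t - h| ^ (-1 - α)) := by
      have p1 : 0 ≤ |t - h| ^ (-1 - α + β) := by positivity
      have p2 : 0 ≤ |t - h| ^ (-1 - α) := by positivity
      rcases min_cases (|t - h| ^ (-1 - α + β)) (|t - h| ^ (-1 - α)) with ⟨e, -⟩ | ⟨e, -⟩
      · rw [e, add_mul]
        have := mul_nonneg hK2 p1
        simp only [hK] at this ⊢
        linarith
      · rw [e, add_mul]
        have := mul_nonneg hK1 p2
        simp only [hK] at this ⊢
        linarith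
    rw [← mul_sub, norm_mul, Real.norm_eq_abs, Real.norm_eq_abs]
    calc _ ≤ |t ^ p - h ^ p| * ((K β Λ + K 0 (2 * Λ)) *
          min (|t - h| ^ (-1 - α + β)) (|t - h| ^ (-1 - α))) := by gcongr
      _ = (K β Λ + K 0 (2 * Λ)) * (|t ^ p - h ^ p| *
          min (|t - h| ^ (-1 - α + β)) (|t - h| ^ (-1 - α))) := by ring
      _ ≤ _ := by
        have := hg t ht hth
        gcongr
  · rw [integral_const_mul, mul_assoc]
    gcongr

/-- The exact slab kernel carries `c⁻¹` and the scaled profile `c^(1+α) h^(p-α)`; the product is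
`h^p (h/c)^(-α)`. -/
theorem tendsto_integral_linear_slabKernel (hα : 0 < α) (hα2 : α < 2) (hp : 0 < p) (hpα : p < α)
    (a : EuclideanSpace ℝ (Fin n)) {h : ℝ} (hh : 0 < h) :
    Tendsto (fun η : ℝ => ∫ t in Ioi (0 : ℝ), (t ^ p - h ^ p) *
        slabKernel (fun u => inner ℝ a u) (((n : ℝ) + 1 + α) / 2) η (t - h)) (𝓝[>] 0)
      (𝓝 (bracketIntegral n (((n : ℝ) + 1 + α) / 2) * gammaConst α p *
        (h ^ p * (h / √(1 + ‖a‖ ^ 2)) ^ (-α)))) := by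
  set c := √(1 + ‖a‖ ^ 2) with hc
  have hc0 : 0 < c := Real.sqrt_pos.2 (by positivity)
  have hc2 : c ^ 2 = 1 + ‖a‖ ^ 2 := Real.sq_sqrt (by positivity)
  set K := bracketIntegral n (((n : ℝ) + 1 + α) / 2) with hK
  have h1 := (tendsto_integral_scaled_profile hα hα2 hp hpα hc0 hh).const_mul (c⁻¹ * K)
  have h2 : c⁻¹ * K * (c ^ (1 + α) * h ^ (p - α) * gammaConst α p) =
      K * gammaConst α p * (h ^ p * (h / c) ^ (-α)) := by
    rw [Real.div_rpow hh.le hc0.le, Real.rpow_neg hc0.le, div_inv_eq_mul, sub_eq_add_neg,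
      Real.rpow_add hh, Real.rpow_add hc0, Real.rpow_one]
    field_simp
  rw [h2] at h1
  refine Tendsto.congr' ?_ h1
  filter_upwards [self_mem_nhdsWithin] with η hη
  rw [← integral_const_mul]
  refine setIntegral_congr_fun measurableSet_Ioi fun t _ => ?_
  simp only [slabKernel]
  rw [integral_slanted_kernel a _ _ hη, ← hc, ← hc2, ← hK,
    show (n : ℝ) / 2 - ((n : ℝ) + 1 + α) / 2 = -((1 + α) / 2) by ring]
  ring

end Comparison

end VerticalDistance

/-! ### Assembling the estimate -/

open VerticalDistance

theorem mainTheorem4 (α β : ℝ) (hα₀ : 0 < α) (hα₂ : α < 2)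
    (hβ₀ : max (α - 1) 0 < β) (hβ₁ : β ≤ 1) :
    ∃ γ : ℝ, 0 < γ ∧
      ∀ (n : ℕ), 1 ≤ n → ∀ (Λ : ℝ), 0 < Λ → ∀ (r₁ : ℝ), 0 < r₁ →
      ∀ (p : ℝ), p ∈ Set.Ico (α - 1) α ∩ Set.Ioo 0 α →
      ∃ A₁ : ℝ, 0 < A₁ ∧
        ∀ G : EuclideanSpace ℝ (Fin n) → ℝ, VerticalDistance.IsC1Holder β Λ G →
          G 0 = 0 → gradient G 0 = 0 →
          ∀ x ∈ VerticalDistance.aboveGraph G, ‖x‖ < r₁ →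
            ∃ L : ℝ,
              VerticalDistance.HasPrincipalValue (VerticalDistance.aboveGraph G)
                (fun y => (VerticalDistance.vertDist G y ^ p - VerticalDistance.vertDist G x ^ p) /
                  ‖y - x‖ ^ (((n + 1 : ℕ) : ℝ) + α)) x L ∧
              |VerticalDistance.normConst (n + 1) α * L -
                  VerticalDistance.codimOneConst (n + 1) α p * VerticalDistance.vertDist G x ^ p *
                    Metric.infDist x (VerticalDistance.aboveGraph G)ᶜ ^ (-α)| ≤
                A₁ * (1 + Metric.infDist x (VerticalDistance.aboveGraph G)ᶜ ^ (p - α + γ) +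
                  |Real.log (Metric.infDist x (VerticalDistance.aboveGraph G)ᶜ)|) := by
  have hβα : α - 1 < β := (le_max_left _ _).trans_lt hβ₀
  have hβ0 : 0 < β := (le_max_right _ _).trans_lt hβ₀
  refine ⟨β, hβ0, fun n hn Λ hΛ r₁ hr₁ p hp => ?_⟩
  obtain ⟨-, hp0, hpα⟩ := hp
  set m := ((n : ℝ) + 1 + α) / 2 with hm
  have hm0 : 0 ≤ m := by positivity
  set K := bracketIntegral n m with hK
  -- As `Γ(0) = 0`, the Lipschitz bound gives `h(x) ≤ (1 + Λ)|x|`, so this range covers every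
  -- admissible `x`.
  obtain ⟨C, hC0, hC⟩ := exists_abs_integral_slabKernel_sub_le hα₀ hα₂ hβα hβ0 hβ₁ hp0 hpα hΛ.le n
    (show 0 < (1 + Λ) * r₁ by positivity)
  set C' := |K * gammaConst α p| * (α * (1 + Λ) ^ (α + 1) * Λ) with hC'
  have hC'0 : 0 ≤ C' := by positivity
  set S := (1 + Λ) ^ |p - α + β| + 1 + Real.log (1 + Λ) with hS
  have hS0 : 0 ≤ S := by
    have : 0 ≤ Real.log (1 + Λ) := Real.log_nonneg (by linarith)
    positivity
  refine ⟨|normConst (n + 1) α| * ((C + C') * S) + 1, by positivity, ?_⟩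
  intro G hG hG0 _ x hx hxr
  have hGc := hG.differentiable.continuous
  obtain ⟨h1, h2⟩ := vertDist_eq hx
  have hhH : vertDist G x ≤ (1 + Λ) * r₁ := by
    have h3 := hG.abs_height_sub_le hΛ.le 0 x
    have h4 : tangential (0 : EuclideanSpace ℝ (Fin (n + 1))) = 0 := by
      ext i; simp [tangential]
    have h5 : height (0 : EuclideanSpace ℝ (Fin (n + 1))) = 0 := by simp [height]
    rw [h4, h5, hG0, sub_zero, sub_zero, sub_zero, ← h1] at h3
    refine ((le_abs_self _).trans h3).trans ?_
    gcongr
  have hBD : Metric.ball x (vertDist G x / (2 * (1 + Λ))) ⊆ aboveGraph G := fun y hy =>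
    (hG.near_of_mem_ball hΛ.le hx hy).1
  have hN := hG.integrableOn_linearCorrected hΛ.le hβ0 hβ₁ hα₂ hβα hp0 hpα hx
  have hFm : Measurable fun y => vertDist G y ^ p - vertDist G x ^ p :=
    ((continuous_vertDist hGc).measurable.pow_const p).sub_const _
  have hpv := hasPrincipalValue_of_linearCorrected hBD
    (show -(2 * m) ≤ 0 by linarith) hN hFm (by omega)
  obtain ⟨hreg, hlim⟩ := tendsto_integral_regularised hBD hm0 hN hFm (by omega)
  set L := ∫ y in aboveGraph G, linearCorrected (fun y => vertDist G y ^ p - vertDist G x ^ p)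
      (slantedFunctional (p * vertDist G x ^ (p - 1)) (gradient G (tangential x))) x
      (vertDist G x / (2 * (1 + Λ))) y * ‖y - x‖ ^ (-(2 * m)) with hL
  refine ⟨L, ?_, ?_⟩
  · have : -(-(2 * m)) = ((n + 1 : ℕ) : ℝ) + α := by rw [hm]; push_cast; ring
    rwa [this] at hpv
  set h := vertDist G x with hh
  set a := gradient G (tangential x) with ha
  set δ := Metric.infDist x (aboveGraph G)ᶜ with hδ
  have hlin := tendsto_integral_linear_slabKernel hα₀ hα₂ hp0 hpα a h2
  rw [← hm, ← hK] at hlin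
  have hcmp : |L - K * gammaConst α p * (h ^ p * (h / √(1 + ‖a‖ ^ 2)) ^ (-α))| ≤
      C * (1 + h ^ (p - α + β) + |Real.log h|) := by
    -- The comparison constant does not depend on `η`, so the bound passes to the limit.
    refine le_of_tendsto (hlim.sub hlin).abs ?_
    filter_upwards [self_mem_nhdsWithin] with η hη
    rw [setIntegral_regularised hGc x hx (hreg η hη)]
    refine hC _ _ (by fun_prop) (by fun_prop) (fun u => ?_) (fun u => ?_) (fun u => ?_) h h2 hhH
      η hη
    · have := hG.abs_sub_le (tangential x + u) (tangential x)
      rwa [add_sub_cancel_left] at this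
    · refine (abs_real_inner_le_norm a u).trans ?_
      gcongr
      exact hG.gradient_le _
    · exact hG.abs_sub_sub_inner_le hΛ.le hβ0 (tangential x) u
  have hdist := hG.abs_rpow_infDist_sub_le hΛ.le hβ0 hx hα₀.le p
  have herr := error_le_of_comparable (q := p - α + β) hΛ.le h2 (hG.div_le_infDist hΛ.le hx)
    (infDist_le_vertDist hx)
  rw [← hh, ← ha, ← hδ] at hdist
  rw [← hδ, ← hS] at herr
  have hcod : codimOneConst (n + 1) α p = normConst (n + 1) α * (K * gammaConst α p) := by
    rw [codimOneConst, hK, hm, bracketIntegral_eq_sphereArea_mul_beta hn hα₀,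
      Nat.add_sub_cancel, Nat.cast_add_one, add_sub_cancel_right]
    ring
  set Q := 1 + h ^ (p - α + β) + |Real.log h| with hQ
  set R := 1 + δ ^ (p - α + β) + |Real.log δ| with hR
  have hR0 : 0 ≤ R := by
    have : 0 ≤ δ := Metric.infDist_nonneg
    positivity
  have hbr : |L - K * gammaConst α p * (h ^ p * δ ^ (-α))| ≤ (C + C') * Q := by
    have e1 : L - K * gammaConst α p * (h ^ p * δ ^ (-α)) =
        (L - K * gammaConst α p * (h ^ p * (h / √(1 + ‖a‖ ^ 2)) ^ (-α))) +
        K * gammaConst α p *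
          (h ^ p * (h / √(1 + ‖a‖ ^ 2)) ^ (-α) - h ^ p * δ ^ (-α)) := by ring
    rw [e1, add_mul]
    refine (abs_add_le _ _).trans (add_le_add hcmp ?_)
    rw [abs_mul, hC']
    have h6 : h ^ (p - α + β) ≤ Q := by
      have := abs_nonneg (Real.log h); linarith
    calc _ ≤ |K * gammaConst α p| * (α * (1 + Λ) ^ (α + 1) * Λ * h ^ (p - α + β)) := by gcongr
      _ ≤ |K * gammaConst α p| * (α * (1 + Λ) ^ (α + 1) * Λ * Q) := by gcongr
      _ = _ := by ring
  have e2 : normConst (n + 1) α * L - codimOneConst (n + 1) α p * h ^ p * δ ^ (-α) =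
      normConst (n + 1) α * (L - K * gammaConst α p * (h ^ p * δ ^ (-α))) := by
    rw [hcod]; ring
  rw [e2, abs_mul]
  calc _ ≤ |normConst (n + 1) α| * ((C + C') * (S * R)) := by
        refine mul_le_mul_of_nonneg_left (hbr.trans ?_) (abs_nonneg _)
        gcongr
    _ = |normConst (n + 1) α| * ((C + C') * S) * R := by ring
    _ ≤ _ := by
      rw [add_mul]
      linarith
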